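/- Conventions. Let $f\in\mathbb{R}[x,y]$ define a real affine curve $\Gamma=\{f=0\}$ with complexification $\Gamma^{\mathbb{C}}\subset\mathbb{C}^2$. The normal to $\Gamma^{\mathbb C}$ (or $\Gamma$) at a nonsingular point $p$ is the line $f_y(p)(X-x(p))-f_x(p)(Y-y(p))=0$. The curve of normals $N_\Gamma\subset(\mathbb{RP}^2)^\vee$ (resp. $N_\Gamma^{\mathbb C}\subset(\mathbb{CP}^2)^\vee$) is the set of normals of $\Gamma$ at its real points (resp. of $\Gamma^{\mathbb{C}}$), and a tilde denotes its projective (Zariski) closure. The $\mathbb{R}$-degree of $N_\Gamma$ is the supremum of the number of real points of $\tilde N_\Gamma\cap\Lambda$ over all real lines $\Lambda\subset(\mathbb{RP}^2)^\vee$ that meet $\tilde N_\Gamma$ transversally. An arrangement of $d$ lines in $\mathbb{R}^2$ is generic if no two lines are parallel and no three are concurrent; let $G$ be the product of linear equations of its lines. For a real polynomial $H$ with $\deg H\le d$ that vanishes at no node of the arrangement, the curves $G+\varepsilon H=0$ with small $\varepsilon>0$ form a Brusotti smoothing of the arrangement. It is called admissible with respect to a point $z\in\mathbb{R}^2$ if,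 for every node $v$ and every neighbourhood $U$ of $v$, for all sufficiently small $\varepsilon>0$ the curve $G+\varepsilon H=0$ has two distinct real normals through $z$ with feet in $U$. Proposition. Let $d\ge 1$. (1) Generic arrangements of $d$ lines exist. For every generic arrangement of $d$ lines in $\mathbb{R}^2$ there are a point $z\in\mathbb{R}^2$ outside the lines and a Brusotti smoothing $G+\varepsilon H=0$, admissible with respect to $z$, such that for all sufficiently small $\varepsilon>0$ the curve $\Gamma=\{G+\varepsilon H=0\}$ has degree $d$, $\Gamma^{\mathbb C}\subset\mathbb{C}^2$ is nonsingular, exactly $d^2$ complex normals to $\Gamma$ pass through $z$, and all of them are real, that is, all their feet are real points of $\Gamma$. Moreover, $\tilde N_\Gamma^{\mathbb C}$ is a plane curve of degree $d^2$, and the $\mathbb{R}$-degree of $N_\Gamma$ equals $d^2$. (2) Consequently, the maximum of the $\mathbb{R}$-degree of $N_\Gamma$ over all real curves $\Gamma=\{f=0\}$ with $f$ squarefree of degree $d$ equals $d^2$. -/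

import Mathlib

open Filter Topology MvPolynomial
open scoped LinearAlgebra.Projectivization

noncomputable section

namespace PlaneNormals

section Field

variable {K : Type*} [Field K]

/-- A point of the dual projective plane over `K`: the class of `(a, b, c)` is the line
`a * X + b * Y + c = 0` (the line at infinity if `a = b = 0`). -/
abbrev DualPlane (K : Type*) [Field K] : Type _ := ℙ K (Fin 3 → K)

/-- Coefficients of the line through `p` whose direction is the gradient of `f` at `p`, that is,
of `f_y(p) * (X - p 0) - f_x(p) * (Y - p 1) = 0`. It is the zero vector exactly when the gradient
of `f` vanishes at `p`. -/
def normalVector (f : MvPolynomial (Fin 2) K) (p : Fin 2 → K) : Fin 3 → K :=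
  ![eval p (pderiv 1 f), - eval p (pderiv 0 f),
    p 1 * eval p (pderiv 0 f) - p 0 * eval p (pderiv 1 f)]

/-- `ℓ` is the normal to the curve `f = 0` at its nonsingular point `p`. -/
def IsNormalAt (f : MvPolynomial (Fin 2) K) (p : Fin 2 → K) (ℓ : DualPlane K) : Prop :=
  eval p f = 0 ∧ ∃ h : normalVector f p ≠ 0, ℓ = Projectivization.mk K (normalVector f p) h

/-- The (quasi-projective) curve of normals of the affine curve `f = 0`, with `K`-points as feet. -/
def curveOfNormals (f : MvPolynomial (Fin 2) K) : Set (DualPlane K) :=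
  {ℓ | ∃ p, IsNormalAt f p ℓ}

/-- The affine point `z`, as a point `[z 0 : z 1 : 1]` of the projective plane. -/
def toProj (z : Fin 2 → K) : ℙ K (Fin 3 → K) :=
  Projectivization.mk K ![z 0, z 1, 1] (fun h => one_ne_zero (congrFun h 2))

/-- A line of the dual plane: the pencil of all lines passing through the point `w` of the
projective plane. -/
def pencil (w : ℙ K (Fin 3 → K)) : Set (DualPlane K) :=
  {ℓ | Projectivization.orthogonal ℓ w}

/-- The normals of the curve `f = 0` that pass through the affine point `z`. -/
def normalsThrough (f : MvPolynomial (Fin 2) K) (z : Fin 2 → K) : Set (DualPlane K) :=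
  curveOfNormals f ∩ pencil (toProj z)

/-- The polynomials in three variables that vanish on (the affine cone over) `S`. -/
def projIdeal (S : Set (DualPlane K)) : Ideal (MvPolynomial (Fin 3) K) :=
  MvPolynomial.vanishingIdeal K
    {v : Fin 3 → K | ∃ hv : v ≠ 0, Projectivization.mk K v hv ∈ S}

/-- The projective (Zariski) closure of `S`. -/
def projClosure (S : Set (DualPlane K)) : Set (DualPlane K) :=
  {ℓ | ∀ g ∈ projIdeal S, eval ℓ.rep g = 0}

/-- The projective closure of `S` is a plane curve of degree `n`: its ideal is generated by one
nonzero form of degree `n`. -/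
def HasDegree (S : Set (DualPlane K)) (n : ℕ) : Prop :=
  ∃ h : MvPolynomial (Fin 3) K, h ≠ 0 ∧ h.IsHomogeneous n ∧ projIdeal S = Ideal.span {h}

/-- The line `pencil w` meets the projective closure of `S` transversally: at every common point
`ℓ`, the tangent line (direction `t`) of `pencil w` is not contained in the Zariski tangent space
of the closure of `S`. In particular all common points are nonsingular points of this closure. -/
def MeetsTransversally (w : ℙ K (Fin 3 → K)) (S : Set (DualPlane K)) : Prop :=
  ∀ ℓ ∈ projClosure S ∩ pencil w, ∃ g ∈ projIdeal S, ∃ t : Fin 3 → K,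
    t ⬝ᵥ w.rep = 0 ∧ ∑ i, eval ℓ.rep (pderiv i g) * t i ≠ 0

/-- The affine curve `f = 0` has no singular `K`-point. -/
def IsNonsingular (f : MvPolynomial (Fin 2) K) : Prop :=
  ∀ p : Fin 2 → K, eval p f = 0 → ∃ i, eval p (pderiv i f) ≠ 0

end Field

/-- The `ℝ`-degree: the supremum of the number of real intersection points with the real lines
that are transversal to the curve. -/
def realDegree (S : Set (DualPlane ℝ)) : ℕ∞ :=
  ⨆ (w : ℙ ℝ (Fin 3 → ℝ)) (_ : MeetsTransversally w S), (projClosure S ∩ pencil w).encard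

/-- The equation of the complexification of the real curve `f = 0`. -/
def complexify (f : MvPolynomial (Fin 2) ℝ) : MvPolynomial (Fin 2) ℂ :=
  MvPolynomial.map (algebraMap ℝ ℂ) f

/-- A real point as a complex point. -/
def toComplex (z : Fin 2 → ℝ) : Fin 2 → ℂ := fun i => (z i : ℂ)

/-- The linear polynomial `l 0 * X + l 1 * Y + l 2`. -/
def linePoly (l : Fin 3 → ℝ) : MvPolynomial (Fin 2) ℝ :=
  C (l 0) * X 0 + C (l 1) * X 1 + C (l 2)

/-- The lines `L i` (given by their coefficients) form a generic arrangement: no two are parallel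
(or equal) and no three pass through one point. -/
structure IsGenericArrangement {d : ℕ} (L : Fin d → Fin 3 → ℝ) : Prop where
  isLine : ∀ i, L i 0 ≠ 0 ∨ L i 1 ≠ 0
  not_parallel : ∀ i j, i ≠ j → L i 0 * L j 1 - L i 1 * L j 0 ≠ 0
  not_concurrent : ∀ i j k, i ≠ j → i ≠ k → j ≠ k → ∀ v : Fin 2 → ℝ,
    ¬ (eval v (linePoly (L i)) = 0 ∧ eval v (linePoly (L j)) = 0 ∧ eval v (linePoly (L k)) = 0)

/-- The nodes of the arrangement: the points that lie on two different lines of it. -/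
def nodes {d : ℕ} (L : Fin d → Fin 3 → ℝ) : Set (Fin 2 → ℝ) :=
  {v | ∃ i j, i ≠ j ∧ eval v (linePoly (L i)) = 0 ∧ eval v (linePoly (L j)) = 0}

/-- The curve `G + ε H = 0`, where `G` is the product of the equations of the lines. If `H` does
not vanish at the nodes, then for small `ε > 0` this is the smoothing of the arrangement in which,
at each node `v`, the two opposite sectors where `G` has the sign of `H(v)` are glued together. -/
def smoothing {d : ℕ} (L : Fin d → Fin 3 → ℝ) (H : MvPolynomial (Fin 2) ℝ) (ε : ℝ) :
    MvPolynomial (Fin 2) ℝ :=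
  (∏ i, linePoly (L i)) + C ε * H

/-- The smoothing prescribed by `H` is admissible at the node `v` with respect to the point `z`:
the curves `G + ε H = 0` with small `ε > 0` have two different real normals through `z` that are
close to the segment from `z` to `v`, that is, with feet in any given neighbourhood `U` of `v`. -/
def IsAdmissibleAt {d : ℕ} (L : Fin d → Fin 3 → ℝ) (H : MvPolynomial (Fin 2) ℝ)
    (z v : Fin 2 → ℝ) : Prop :=
  ∀ U ∈ 𝓝 v, ∀ᶠ ε in 𝓝[>] (0 : ℝ), ∃ p ∈ U, ∃ q ∈ U, ∃ ℓ ∈ pencil (toProj z),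
    ∃ m ∈ pencil (toProj z), ℓ ≠ m ∧
      IsNormalAt (smoothing L H ε) p ℓ ∧ IsNormalAt (smoothing L H ε) q m

/-- The smoothing of the arrangement prescribed by `H` is an admissible Brusotti smoothing with
respect to `z`: it is of the same degree, smooths every node, and is admissible at every node. -/
structure IsAdmissibleSmoothing {d : ℕ} (L : Fin d → Fin 3 → ℝ) (H : MvPolynomial (Fin 2) ℝ)
    (z : Fin 2 → ℝ) : Prop where
  totalDegree_le : H.totalDegree ≤ d
  ne_zero : ∀ v ∈ nodes L, eval v H ≠ 0
  admissible : ∀ v ∈ nodes L, IsAdmissibleAt L H z v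

/-- All complex normals through the real point `z` to the real curve `f = 0` are real: every foot
of such a normal is a real point of the curve. -/
def AllNormalsReal (f : MvPolynomial (Fin 2) ℝ) (z : Fin 2 → ℝ) : Prop :=
  ∀ p ℓ, IsNormalAt (complexify f) p ℓ → ℓ ∈ pencil (toProj (toComplex z)) →
    ∃ q : Fin 2 → ℝ, p = toComplex q

end PlaneNormals

end

/-!
Through a point `z` outside the curve `f = 0` of degree `d`, the feet of normals are the common
points of `f = 0` and `rotation z f = 0`, where `rotation z` is the infinitesimal rotation about
`z`. Both curves have degree at most `d`, so by Bézout's theorem there are at most `d ^ 2` feet.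
The top homogeneous component of `rotation z f` does not depend on `z`, and if it has no common
factor with that of `f` and some `z` sees `d ^ 2` feet in different directions, then these are all.
The curve of normals then has degree `d ^ 2`, since the pencil of lines through `z` meets it
in `d ^ 2` points.

For `ε → 0`, the smoothing of an arrangement of `d` lines has `d` feet near the feet of the
perpendiculars from `z` to the lines (by the implicit function theorem), and, after blowing up the
node `v` by `p = v + √ε • y`, two feet near each node `v` as soon as `H v` has the right value. This
gives `d + 2 * (d choose 2) = d ^ 2` real feet. The values at the nodes are prescribed by an `H` of
degree less than `d`, so the top homogeneous component of `f` is that of the arrangement.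
-/

noncomputable section

namespace PlaneNormals

/-! ### Dimension counts and Bézout's inequality -/

section Dimension

variable (σ K : Type*) [Fintype σ] [Field K]

theorem finrank_homogeneousSubmodule (e : ℕ) :
    Module.finrank K (homogeneousSubmodule σ K e) = (Fintype.card σ).multichoose e := by
  classical
  rw [homogeneousSubmodule_eq_finsupp_supported, ← restrictSupport,
    Module.finrank_eq_nat_card_basis (basisRestrictSupport K {n : σ →₀ ℕ | n.degree = e}),
    ← Finset.card_univ (α := σ), ← Finset.card_finsuppAntidiag_nat_eq_multichoose,
    Nat.card_coe_set_eq, ← Set.ncard_coe_finset]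
  congr 1
  ext n
  simp [Finsupp.degree_eq_sum]

theorem finrank_restrictTotalDegree (e : ℕ) :
    Module.finrank K (restrictTotalDegree σ K e) = (Fintype.card σ + 1).multichoose e := by
  classical
  have exponents_eq : {n : σ →₀ ℕ | (n.sum fun _ k => k) ≤ e} =
      ((Finset.range (e + 1)).biUnion (Finset.univ.finsuppAntidiag) : Finset (σ →₀ ℕ)) := by
    ext n
    simp [Finsupp.sum_fintype]
  rw [restrictTotalDegree,
    Module.finrank_eq_nat_card_basis
      (basisRestrictSupport K {n : σ →₀ ℕ | (n.sum fun _ k => k) ≤ e}),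
    Nat.card_coe_set_eq, exponents_eq, Set.ncard_coe_finset, Finset.card_biUnion]
  · simp only [Finset.card_finsuppAntidiag_nat_eq_multichoose, Finset.card_univ]
    rw [Nat.sum_range_multichoose, Nat.multichoose_eq, ← Nat.choose_symm_add]
    congr 1
    omega
  · intro i _ j _ hij
    rw [Function.onFun, Finset.disjoint_left]
    intro n hi hj
    exact hij ((Finset.mem_finsuppAntidiag.1 hi).1.symm.trans (Finset.mem_finsuppAntidiag.1 hj).1)

end Dimension

instance finiteDimensional_homogeneousSubmodule (σ K : Type*) [Finite σ] [Field K] (e : ℕ) :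
    FiniteDimensional K (homogeneousSubmodule σ K e) :=
  Module.Finite.of_fg (homogeneousSubmodule_fg σ K e)

theorem two_mul_multichoose_three (e : ℕ) : 2 * Nat.multichoose 3 e = (e + 1) * (e + 2) := by
  rw [Nat.multichoose_eq, show 3 + e - 1 = e + 2 by omega, Nat.choose_symm_add,
    Nat.choose_two_right, mul_comm 2]
  rw [Nat.div_mul_cancel (Nat.even_mul_pred_self _).two_dvd]
  simp [mul_comm]

section LinearAlgebra

variable {K V W : Type*} [Field K] [AddCommGroup V] [Module K V] [AddCommGroup W] [Module K W]

theorem finrank_add_finrank_le_of_map_le {φ : V →ₗ[K] W} {A : Submodule K V}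
    {B T : Submodule K W} [FiniteDimensional K A] [FiniteDimensional K B] (hA : A.map φ ≤ B)
    (hT : T ≤ B) :
    Module.finrank K A + Module.finrank K T ≤
      Module.finrank K B + Module.finrank K (A ⊓ T.comap φ : Submodule K V) := by
  have := Submodule.finiteDimensional_of_le hT
  let θ : (A × T) →ₗ[K] B :=
    (φ.restrict fun a ha => hA (Submodule.mem_map_of_mem ha)).coprod (-Submodule.inclusion hT)
  have mem_ker {x : A × T} (hx : x ∈ θ.ker) : φ x.1 = x.2 := by
    have := congrArg Subtype.val (LinearMap.mem_ker.1 hx)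
    simpa [θ, add_neg_eq_zero] using this
  let ψ : θ.ker →ₗ[K] (A ⊓ T.comap φ : Submodule K V) :=
    ((A.subtype ∘ₗ LinearMap.fst K A T) ∘ₗ θ.ker.subtype).codRestrict _ fun x =>
      ⟨x.1.1.2, by simp [mem_ker x.2]⟩
  have ψ_injective : Function.Injective ψ := by
    intro x y hxy
    have hfst : x.1.1 = y.1.1 := Subtype.ext (congrArg Subtype.val hxy :)
    have hsnd : x.1.2 = y.1.2 := Subtype.ext (by rw [← mem_ker x.2, ← mem_ker y.2, hfst])
    exact Subtype.ext (Prod.ext hfst hsnd)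
  have h_ker := LinearMap.finrank_le_finrank_of_injective ψ_injective
  have h_range := Submodule.finrank_le θ.range
  have h_sum := θ.finrank_range_add_finrank_ker
  rw [Module.finrank_prod] at h_sum
  omega

theorem card_add_finrank_le_of_separating {ι : Type*} [Fintype ι] (ev : ι → V →ₗ[K] K)
    {U B : Submodule K V} [FiniteDimensional K B] (hUB : U ≤ B) (hU : ∀ i, ∀ a ∈ U, ev i a = 0)
    (hsep : ∀ i, ∃ a ∈ B, ev i a ≠ 0 ∧ ∀ j, j ≠ i → ev j a = 0) :
    Fintype.card ι + Module.finrank K U ≤ Module.finrank K B := by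
  classical
  let E : B →ₗ[K] (ι → K) := LinearMap.pi ev ∘ₗ B.subtype
  have E_surjective : Function.Surjective E := by
    rw [← LinearMap.range_eq_top, eq_top_iff, ← (Pi.basisFun K ι).span_eq, Submodule.span_le]
    rintro _ ⟨i, rfl⟩
    obtain ⟨a, haB, hai, haj⟩ := hsep i
    refine ⟨(ev i a)⁻¹ • ⟨a, haB⟩, ?_⟩
    ext j
    rcases eq_or_ne j i with rfl | hji
    · simp [E, hai]
    · simp [E, haj j hji, hji]
  let ψ : U →ₗ[K] E.ker := (Submodule.inclusion hUB).codRestrict E.ker fun u =>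
    LinearMap.mem_ker.2 (funext fun i => hU i u u.2)
  have ψ_injective : Function.Injective ψ := fun u v huv =>
    Subtype.ext (congrArg (fun x : E.ker => (x : V)) huv :)
  have h_ker := LinearMap.finrank_le_finrank_of_injective ψ_injective
  have h_sum := E.finrank_range_add_finrank_ker
  rw [LinearMap.range_eq_top.2 E_surjective, finrank_top, Module.finrank_pi] at h_sum
  omega

end LinearAlgebra

section Bezout

variable {K : Type*} [Field K]

/-- Multiplication by `f` raises the degrees of the filtration `V` by exactly `m`. -/
def HasFiltrationDegree {R : Type*} [CommRing R] [Algebra K R] (V : ℕ → Submodule K R) (f : R)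
    (m : ℕ) : Prop :=
  ∀ e a, f * a ∈ V (e + m) ↔ a ∈ V e

theorem finrank_map_mulLeft {R : Type*} [CommRing R] [IsDomain R] [Algebra K R] {f : R}
    (hf : f ≠ 0) (U : Submodule K R) :
    Module.finrank K (U.map (LinearMap.mulLeft K f)) = Module.finrank K U :=
  (LinearEquiv.finrank_eq (Submodule.equivMapOfInjective _
    (mul_right_injective₀ hf) U)).symm

theorem finrank_le_of_isRelPrime {R : Type*} [CommRing R] [IsDomain R] [DecompositionMonoid R]
    [Algebra K R] {V : ℕ → Submodule K R} [∀ e, FiniteDimensional K (V e)] {f g : R} {m n e : ℕ}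
    (hg0 : g ≠ 0) (hg : HasFiltrationDegree V g n) (hfg : IsRelPrime f g) :
    Module.finrank K (V (e + n)) + Module.finrank K (V (e + m)) ≤
      Module.finrank K ((V (e + n)).map (LinearMap.mulLeft K f) ⊔
        (V (e + m)).map (LinearMap.mulLeft K g) : Submodule K R) + Module.finrank K (V e) := by
  have syzygy_le : (V (e + n) ⊓ ((V (e + m)).map (LinearMap.mulLeft K g)).comap
      (LinearMap.mulLeft K f) : Submodule K R) ≤ (V e).map (LinearMap.mulLeft K g) := by
    rintro a ⟨ha, b, -, hb⟩
    obtain ⟨c, rfl⟩ : g ∣ a := hfg.symm.dvd_of_dvd_mul_left ⟨b, hb.symm⟩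
    exact ⟨c, (hg e c).1 ha, rfl⟩
  have h := finrank_add_finrank_le_of_map_le (φ := LinearMap.mulLeft K f)
    (le_sup_left : (V (e + n)).map (LinearMap.mulLeft K f) ≤ _)
    (le_sup_right : (V (e + m)).map (LinearMap.mulLeft K g) ≤ _)
  have h_syzygy := Submodule.finrank_mono syzygy_le
  rw [finrank_map_mulLeft hg0] at h h_syzygy
  omega

theorem card_le_mul_of_isRelPrime {R : Type*} [CommRing R] [IsDomain R] [DecompositionMonoid R]
    [Algebra K R] {V : ℕ → Submodule K R} [∀ e, FiniteDimensional K (V e)]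
    (hV : ∀ e, 2 * Module.finrank K (V e) = (e + 1) * (e + 2)) {f g : R} {m n : ℕ}
    (hf : HasFiltrationDegree V f m) (hg : HasFiltrationDegree V g n) (hg0 : g ≠ 0)
    (hfg : IsRelPrime f g) {ι : Type*} [Fintype ι] (ev : ι → R →ₗ[K] K)
    (hevf : ∀ i a, ev i (f * a) = 0) (hevg : ∀ i a, ev i (g * a) = 0)
    (hsep : ∃ e₀, ∀ e, e₀ ≤ e → ∀ i, ∃ a ∈ V e, ev i a ≠ 0 ∧ ∀ j, j ≠ i → ev j a = 0) :
    Fintype.card ι ≤ m * n := by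
  obtain ⟨e, he⟩ := hsep
  have h_syzygy := finrank_le_of_isRelPrime (m := m) (e := e) hg0 hg hfg
  have h_eval := card_add_finrank_le_of_separating (B := V (e + n + m)) ev
    (U := (V (e + n)).map (LinearMap.mulLeft K f) ⊔ (V (e + m)).map (LinearMap.mulLeft K g)) (by
      rw [sup_le_iff, Submodule.map_le_iff_le_comap, Submodule.map_le_iff_le_comap]
      exact ⟨fun a ha => (hf _ a).2 ha, fun a ha => by
        simpa [add_right_comm] using (hg (e + m) a).2 ha⟩)
    (by
      intro i x hx
      obtain ⟨_, ⟨a, -, rfl⟩, _, ⟨b, -, rfl⟩, rfl⟩ := Submodule.mem_sup.1 hx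
      simp [hevf, hevg])
    (he _ (by omega))
  have := hV e
  have := hV (e + n)
  have := hV (e + m)
  have := hV (e + n + m)
  nlinarith

theorem encard_le_of_forall_finset {α : Type*} {s : Set α} {n : ℕ}
    (h : ∀ t : Finset α, (t : Set α) ⊆ s → t.card ≤ n) : s.encard ≤ n := by
  by_contra! hlt
  obtain ⟨t, hts, htcard⟩ := Set.exists_subset_encard_eq (Order.add_one_le_of_lt hlt)
  have htfin : t.Finite := Set.finite_of_encard_le_coe (k := n + 1) (by rw [htcard]; simp)
  have hle := h htfin.toFinset (by simpa using hts)
  rw [← Nat.cast_le (α := ℕ∞), ← Set.encard_coe_eq_coe_finsetCard, htfin.coe_toFinset,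
    htcard] at hle
  exact absurd hle (by exact_mod_cast (Nat.lt_succ_self n).not_ge)

theorem hasFiltrationDegree_totalDegree {σ : Type*} {f : MvPolynomial σ K} (hf : f ≠ 0) :
    HasFiltrationDegree (restrictTotalDegree σ K) f f.totalDegree := by
  intro e a
  rw [mem_restrictTotalDegree, mem_restrictTotalDegree]
  by_cases ha : a = 0
  · simp [ha]
  · rw [totalDegree_mul_of_isDomain hf ha]
    omega

theorem exists_separating_polynomial {σ : Type*} (t : Finset (σ → K)) {e : ℕ} (he : t.card ≤ e)
    {p : σ → K} :
    ∃ a : MvPolynomial σ K, a.totalDegree ≤ e ∧ eval p a ≠ 0 ∧ ∀ q ∈ t, q ≠ p → eval q a = 0 := by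
  classical
  have exists_linear (q : σ → K) (hq : q ≠ p) :
      ∃ a : MvPolynomial σ K, a.totalDegree ≤ 1 ∧ eval p a ≠ 0 ∧ eval q a = 0 := by
    obtain ⟨i, hi⟩ := Function.ne_iff.1 hq
    exact ⟨X i - C (q i), (totalDegree_sub _ _).trans (by simp), by simp [sub_eq_zero, hi.symm],
      by simp⟩
  choose! a ha_deg hap haq using exists_linear
  refine ⟨∏ q ∈ t.erase p, a q, ?_, ?_, fun q hq hqp => ?_⟩
  · calc (∏ q ∈ t.erase p, a q).totalDegree
        ≤ ∑ q ∈ t.erase p, (a q).totalDegree := totalDegree_finsetProd _ _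
      _ ≤ (t.erase p).card • 1 := Finset.sum_le_card_nsmul _ _ 1 fun q hq =>
          ha_deg q (Finset.ne_of_mem_erase hq)
      _ ≤ e := by simpa using (Finset.card_le_card (t.erase_subset p)).trans he
  · rw [map_prod, Finset.prod_ne_zero_iff]
    exact fun q hq => hap q (Finset.ne_of_mem_erase hq)
  · rw [map_prod]
    exact Finset.prod_eq_zero (Finset.mem_erase.2 ⟨hqp, hq⟩) (haq q hqp)

theorem encard_commonZeros_le {f g : MvPolynomial (Fin 2) K} (hf : f ≠ 0) (hg : g ≠ 0)
    (hfg : IsRelPrime f g) :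
    {p : Fin 2 → K | eval p f = 0 ∧ eval p g = 0}.encard ≤
      ((f.totalDegree * g.totalDegree : ℕ) : ℕ∞) := by
  refine encard_le_of_forall_finset fun t ht => ?_
  rw [← Fintype.card_coe]
  refine card_le_mul_of_isRelPrime
    (fun e => by rw [finrank_restrictTotalDegree]; exact two_mul_multichoose_three e)
    (hasFiltrationDegree_totalDegree hf) (hasFiltrationDegree_totalDegree hg) hg hfg
    (fun p : t => (aeval (R := K) p.1).toLinearMap)
    (fun p a => by simp [aeval_eq_eval, (ht p.2).1])
    (fun p a => by simp [aeval_eq_eval, (ht p.2).2])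
    ⟨t.card, fun e he p => ?_⟩
  obtain ⟨a, ha, hp, hq⟩ := exists_separating_polynomial t he (p := p)
  exact ⟨a, (mem_restrictTotalDegree _ _ _).2 ha, by simpa [aeval_eq_eval] using hp, fun q hqp => by
    simpa [aeval_eq_eval] using hq q q.2 (Subtype.coe_ne_coe.2 hqp)⟩

end Bezout

/-! ### Homogeneous components -/

section Dilate

variable {σ : Type*} {K : Type*} [Field K]

/-- The substitution `x ↦ t x`, as a polynomial in `t`: the coefficient of `t ^ m` is the
homogeneous component of degree `m`, which reduces statements about homogeneous components to
univariate ones. -/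
def dilate : MvPolynomial σ K →ₐ[K] Polynomial (MvPolynomial σ K) :=
  aeval fun i => Polynomial.C (X i) * Polynomial.X

theorem dilate_X (i : σ) :
    dilate (X i : MvPolynomial σ K) = Polynomial.C (X i) * Polynomial.X :=
  aeval_X _ i

theorem dilate_of_isHomogeneous {p : MvPolynomial σ K} {n : ℕ} (hp : p.IsHomogeneous n) :
    dilate p = Polynomial.C p * Polynomial.X ^ n := by
  have dilate_monomial {s : σ →₀ ℕ} (hs : s ∈ p.support) : dilate (monomial s (coeff s p)) =
      Polynomial.C (monomial s (coeff s p)) * Polynomial.X ^ n := by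
    rw [dilate, aeval_monomial, monomial_eq (s := s), hp.degree_eq_sum_deg_support hs]
    simp only [mul_pow, Finsupp.prod, Finset.prod_mul_distrib, Finset.prod_pow_eq_pow_sum, map_mul,
      map_prod, map_pow, mul_assoc]
    rfl
  conv_lhs => rw [p.as_sum]
  conv_rhs => rw [p.as_sum]
  rw [map_sum, map_sum, Finset.sum_mul]
  exact Finset.sum_congr rfl fun s hs => dilate_monomial hs

theorem dilate_eq_sum (p : MvPolynomial σ K) :
    dilate p = ∑ i ∈ Finset.range (p.totalDegree + 1),
      Polynomial.C (homogeneousComponent i p) * Polynomial.X ^ i := by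
  conv_lhs => rw [← sum_homogeneousComponent p, map_sum]
  exact Finset.sum_congr rfl fun i _ =>
    dilate_of_isHomogeneous (homogeneousComponent_isHomogeneous i p)

theorem coeff_dilate (p : MvPolynomial σ K) (m : ℕ) :
    (dilate p).coeff m = homogeneousComponent m p := by
  rw [dilate_eq_sum, Polynomial.finsetSum_coeff]
  simp only [Polynomial.coeff_C_mul_X_pow]
  rw [Finset.sum_ite_eq]
  split_ifs with h
  · rfl
  · rw [homogeneousComponent_eq_zero]
    simpa using h

theorem eval_one_dilate (p : MvPolynomial σ K) : (dilate p).eval 1 = p := by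
  rw [dilate_eq_sum, Polynomial.eval_finsetSum]
  simp [sum_homogeneousComponent]

theorem dilate_ne_zero {p : MvPolynomial σ K} (hp : p ≠ 0) : dilate p ≠ 0 := fun h =>
  hp (by rw [← eval_one_dilate p, h, Polynomial.eval_zero])

theorem natDegree_dilate_le (p : MvPolynomial σ K) : (dilate p).natDegree ≤ p.totalDegree := by
  rw [Polynomial.natDegree_le_iff_coeff_eq_zero]
  intro m hm
  rw [coeff_dilate, homogeneousComponent_eq_zero _ _ hm]

theorem isHomogeneous_of_natTrailingDegree_eq {p : MvPolynomial σ K}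
    (h : (dilate p).natTrailingDegree = (dilate p).natDegree) :
    p.IsHomogeneous (dilate p).natDegree := by
  suffices hp : p = homogeneousComponent (dilate p).natDegree p by
    have := homogeneousComponent_isHomogeneous (dilate p).natDegree p
    rwa [← hp] at this
  conv_lhs => rw [← eval_one_dilate p, Polynomial.eval_eq_sum_range]
  rw [← coeff_dilate, Finset.sum_eq_single (dilate p).natDegree]
  · rw [one_pow, mul_one]
  · intro i hi hne
    rw [Polynomial.coeff_eq_zero_of_lt_natTrailingDegree, zero_mul]
    rw [h]
    exact lt_of_le_of_ne (by simpa [Nat.lt_succ_iff] using hi) hne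
  · simp

theorem isHomogeneous_of_mul {p q : MvPolynomial σ K} {n : ℕ} (h : (p * q).IsHomogeneous n)
    (h0 : p * q ≠ 0) :
    ∃ i j, i + j = n ∧ p.IsHomogeneous i ∧ q.IsHomogeneous j := by
  have hp := dilate_ne_zero (left_ne_zero_of_mul h0)
  have hq := dilate_ne_zero (right_ne_zero_of_mul h0)
  have h_nat : (dilate (p * q)).natDegree = n := by
    rw [dilate_of_isHomogeneous h, Polynomial.natDegree_C_mul_X_pow n _ h0]
  have h_trailing : (dilate (p * q)).natTrailingDegree = n := by
    rw [dilate_of_isHomogeneous h, Polynomial.C_mul_X_pow_eq_monomial,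
      Polynomial.natTrailingDegree_monomial h0]
  rw [map_mul, Polynomial.natDegree_mul hp hq] at h_nat
  rw [map_mul, Polynomial.natTrailingDegree_mul hp hq] at h_trailing
  have hp_le := Polynomial.natTrailingDegree_le_natDegree (dilate p)
  have hq_le := Polynomial.natTrailingDegree_le_natDegree (dilate q)
  exact ⟨_, _, h_nat, isHomogeneous_of_natTrailingDegree_eq (by omega),
    isHomogeneous_of_natTrailingDegree_eq (by omega)⟩

theorem hasFiltrationDegree_of_isHomogeneous {p : MvPolynomial σ K} {m : ℕ}
    (hp : p.IsHomogeneous m) (hp0 : p ≠ 0) :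
    HasFiltrationDegree (homogeneousSubmodule σ K) p m := by
  intro e a
  rw [mem_homogeneousSubmodule, mem_homogeneousSubmodule]
  refine ⟨fun h => ?_, fun h => add_comm m e ▸ hp.mul h⟩
  rcases eq_or_ne a 0 with rfl | ha
  · exact isHomogeneous_zero _ _ _
  · obtain ⟨i, j, hij, hi, hj⟩ := isHomogeneous_of_mul h (mul_ne_zero hp0 ha)
    obtain rfl : j = e := by
      have := hi.inj_right hp hp0
      omega
    exact hj

theorem eval_map_dilate (v : σ → K) (c : K) (p : MvPolynomial σ K) :
    ((dilate p).map (eval v)).eval c = eval (c • v) p := by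
  induction p using MvPolynomial.induction_on with
  | C a => simp [dilate, Polynomial.algebraMap_apply]
  | add q r hq hr => simp [hq, hr]
  | mul_X q i hq => simp [hq, dilate_X, mul_comm c]

theorem eval_smul_of_isHomogeneous {p : MvPolynomial σ K} {m : ℕ} (hp : p.IsHomogeneous m) (c : K)
    (v : σ → K) : eval (c • v) p = c ^ m * eval v p := by
  rw [← eval_map_dilate, dilate_of_isHomogeneous hp, Polynomial.map_mul, Polynomial.map_C,
    Polynomial.map_pow, Polynomial.map_X, Polynomial.eval_C_mul, Polynomial.eval_X_pow, mul_comm]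

theorem homogeneousComponent_mul {p q : MvPolynomial σ K} {m n : ℕ} (hp : p.totalDegree ≤ m)
    (hq : q.totalDegree ≤ n) :
    homogeneousComponent (m + n) (p * q) = homogeneousComponent m p * homogeneousComponent n q := by
  simp only [← coeff_dilate, map_mul]
  exact Polynomial.coeff_mul_add_eq_of_natDegree_le ((natDegree_dilate_le p).trans hp)
    ((natDegree_dilate_le q).trans hq)

theorem homogeneousComponent_prod {ι : Type*} (s : Finset ι) (p : ι → MvPolynomial σ K) {n : ℕ}
    (hp : ∀ i ∈ s, (p i).totalDegree ≤ n) :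
    homogeneousComponent (s.card * n) (∏ i ∈ s, p i) = ∏ i ∈ s, homogeneousComponent n (p i) := by
  simp only [← coeff_dilate, map_prod]
  exact Polynomial.coeff_prod_of_natDegree_le _ _ _ fun i hi =>
    (natDegree_dilate_le _).trans (hp i hi)

theorem homogeneousComponent_pderiv (i : σ) (p : MvPolynomial σ K) (n : ℕ) :
    homogeneousComponent n (pderiv i p) = pderiv i (homogeneousComponent (n + 1) p) := by
  ext s
  simp [coeff_homogeneousComponent, coeff_pderiv, map_add, ite_mul]

theorem homogeneousComponent_dvd_of_dvd {p q : MvPolynomial σ K} {m : ℕ} (hpq : p ∣ q)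
    (hq : q.totalDegree ≤ m) :
    homogeneousComponent p.totalDegree p ∣ homogeneousComponent m q := by
  obtain ⟨a, rfl⟩ := hpq
  rcases eq_or_ne (p * a) 0 with h0 | h0
  · simp [h0]
  · rw [totalDegree_mul_of_isDomain (left_ne_zero_of_mul h0) (right_ne_zero_of_mul h0)] at hq
    obtain ⟨k, rfl⟩ := Nat.exists_eq_add_of_le ((Nat.le_add_right _ _).trans hq)
    exact ⟨_, homogeneousComponent_mul le_rfl (by omega)⟩

theorem isRelPrime_of_isRelPrime_homogeneousComponent {p q : MvPolynomial σ K} {m n : ℕ}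
    (hp : p.totalDegree ≤ m) (hq : q.totalDegree ≤ n)
    (h : IsRelPrime (homogeneousComponent m p) (homogeneousComponent n q)) : IsRelPrime p q := by
  intro k hkp hkq
  have h_unit := h (homogeneousComponent_dvd_of_dvd hkp hp) (homogeneousComponent_dvd_of_dvd hkq hq)
  have h_degree : k.totalDegree = 0 := by
    rw [← (homogeneousComponent_isHomogeneous k.totalDegree k).totalDegree h_unit.ne_zero]
    exact (isUnit_iff_totalDegree_of_isReduced.1 h_unit).2
  obtain ⟨c, rfl⟩ : ∃ c, k = C c := ⟨_, totalDegree_eq_zero_iff_eq_C.1 h_degree⟩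
  simpa using h_unit

end Dilate

/-! ### Linear forms and projective zeros -/

theorem eval_aeval {σ τ R : Type*} [CommSemiring R] (n : σ → MvPolynomial τ R) (p : τ → R)
    (g : MvPolynomial σ R) : eval p (aeval n g) = eval (fun i => eval p (n i)) g := by
  rw [← coe_aeval_eq_eval, ← coe_aeval_eq_eval, RingHom.coe_coe, RingHom.coe_coe, comp_aeval_apply]

section LinForm

variable {σ K : Type*} [Fintype σ] [Field K]

/-- The linear form with coefficients `u`. -/
def linForm (u : σ → K) : MvPolynomial σ K := ∑ i, C (u i) * X i

@[simp]
theorem eval_linForm (u v : σ → K) : eval v (linForm u) = v ⬝ᵥ u := by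
  simp [linForm, dotProduct, mul_comm]

theorem isHomogeneous_linForm (u : σ → K) : (linForm u).IsHomogeneous 1 :=
  IsHomogeneous.sum _ _ _ fun _ _ => isHomogeneous_C_mul_X _ _

theorem linForm_dvd_of_forall_eval_eq_zero [Infinite K] {w : σ → K} (hw : w ≠ 0)
    {g : MvPolynomial σ K} (hg : ∀ u, u ⬝ᵥ w = 0 → eval u g = 0) : linForm w ∣ g := by
  classical
  obtain ⟨i, hi⟩ := Function.ne_iff.1 hw
  let e : σ → K := Pi.single i (w i)⁻¹
  have he : e ⬝ᵥ w = 1 := by simp [e, inv_mul_cancel₀ hi]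
  let τ : MvPolynomial σ K →ₐ[K] MvPolynomial σ K := aeval fun j => X j - C (e j) * linForm w
  have τ_eq : (Ideal.Quotient.mkₐ K (Ideal.span {linForm w})).comp τ =
      Ideal.Quotient.mkₐ K (Ideal.span {linForm w}) := by
    refine algHom_ext fun j => ?_
    rw [AlgHom.comp_apply, aeval_X, Ideal.Quotient.mkₐ_eq_mk, Ideal.Quotient.mk_eq_mk_iff_sub_mem,
      sub_sub_cancel_left, neg_mem_iff]
    exact Ideal.mul_mem_left _ _ (Ideal.mem_span_singleton_self _)
  have eval_τ (u : σ → K) : eval u (τ g) = eval (u - (u ⬝ᵥ w) • e) g := by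
    rw [eval_aeval]
    congr 2
    ext j
    simp [mul_comm]
  have τ_g : τ g = 0 := MvPolynomial.funext fun u => by
    rw [eval_τ, map_zero]
    exact hg _ (by rw [sub_dotProduct, smul_dotProduct, he, smul_eq_mul, mul_one, sub_self])
  rw [← Ideal.mem_span_singleton, ← Ideal.Quotient.eq_zero_iff_mem, ← Ideal.Quotient.mkₐ_eq_mk K,
    ← τ_eq, AlgHom.comp_apply, τ_g, map_zero]

theorem exists_dotProduct_ne_zero {v : σ → K} (hv : v ≠ 0) : ∃ u, v ⬝ᵥ u ≠ 0 := by
  contrapose! hv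
  exact dotProduct_eq_zero v hv

theorem exists_dotProduct_separating {p q : ℙ K (σ → K)} (hpq : q ≠ p) :
    ∃ u : σ → K, p.rep ⬝ᵥ u ≠ 0 ∧ q.rep ⬝ᵥ u = 0 := by
  classical
  have hp : p.rep ∉ Submodule.span K {q.rep} := by
    rw [Submodule.mem_span_singleton]
    rintro ⟨c, hc⟩
    refine hpq ?_
    rw [← p.mk_rep, ← q.mk_rep, eq_comm, Projectivization.mk_eq_mk_iff']
    exact ⟨c, hc⟩
  obtain ⟨φ, hφp, hφq⟩ := Submodule.exists_le_ker_of_notMem hp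
  have φ_apply (v : σ → K) : v ⬝ᵥ (fun i => φ (Pi.single i 1)) = φ v := by
    conv_rhs => rw [LinearMap.pi_apply_eq_sum_univ φ v]
    refine Finset.sum_congr rfl fun i _ => ?_
    rw [smul_eq_mul]
    exact congrArg (v i * φ ·) (funext fun j => by simp [Pi.single_apply, eq_comm])
  refine ⟨fun i => φ (Pi.single i 1), ?_, ?_⟩
  · rwa [φ_apply]
  · rw [φ_apply]
    exact hφq (Submodule.mem_span_singleton_self _)

end LinForm

theorem exists_separating_form {σ K : Type*} [Finite σ] [Field K] (t : Finset (ℙ K (σ → K)))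
    {e : ℕ} (he : t.card ≤ e) (p : ℙ K (σ → K)) :
    ∃ a : MvPolynomial σ K, a.IsHomogeneous e ∧ eval p.rep a ≠ 0 ∧
      ∀ q ∈ t, q ≠ p → eval q.rep a = 0 := by
  classical
  cases nonempty_fintype σ
  choose! u hup huq using fun q (hq : q ≠ p) => exists_dotProduct_separating hq
  obtain ⟨u₀, hu₀⟩ := exists_dotProduct_ne_zero p.rep_nonzero
  refine ⟨(∏ q ∈ t.erase p, linForm (u q)) * linForm u₀ ^ (e - (t.erase p).card), ?_, ?_,
    fun q hq hqp => ?_⟩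
  · have h_prod := IsHomogeneous.prod (t.erase p) (fun q => linForm (u q)) (fun _ => 1)
      fun q _ => isHomogeneous_linForm _
    have h_card := (Finset.card_le_card (t.erase_subset p)).trans he
    convert h_prod.mul ((isHomogeneous_linForm u₀).pow (e - (t.erase p).card)) using 1
    simp [h_card]
  · rw [map_mul, map_prod, map_pow, eval_linForm]
    refine mul_ne_zero (Finset.prod_ne_zero_iff.2 fun q hq => ?_) (pow_ne_zero _ hu₀)
    rw [eval_linForm]
    exact hup q (Finset.ne_of_mem_erase hq)
  · rw [map_mul, map_prod, Finset.prod_eq_zero (Finset.mem_erase.2 ⟨hqp, hq⟩), zero_mul]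
    rw [eval_linForm, huq q hqp]

section ProjIdeal

variable {K : Type*} [Field K]

theorem encard_projective_commonZeros_le {f g : MvPolynomial (Fin 3) K} {m n : ℕ} (hf : f ≠ 0)
    (hg : g ≠ 0) (hfm : f.IsHomogeneous m) (hgn : g.IsHomogeneous n) (hfg : IsRelPrime f g) :
    {p : ℙ K (Fin 3 → K) | eval p.rep f = 0 ∧ eval p.rep g = 0}.encard ≤ ((m * n : ℕ) : ℕ∞) := by
  refine encard_le_of_forall_finset fun t ht => ?_
  rw [← Fintype.card_coe]
  refine card_le_mul_of_isRelPrime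
    (fun e => by rw [finrank_homogeneousSubmodule]; exact two_mul_multichoose_three e)
    (hasFiltrationDegree_of_isHomogeneous hfm hf) (hasFiltrationDegree_of_isHomogeneous hgn hg)
    hg hfg (fun p : t => (aeval (R := K) p.1.rep).toLinearMap)
    (fun p a => by simp [aeval_eq_eval, (ht p.2).1])
    (fun p a => by simp [aeval_eq_eval, (ht p.2).2])
    ⟨t.card, fun e he p => ?_⟩
  obtain ⟨a, ha, hp, hq⟩ := exists_separating_form t he p
  exact ⟨a, ha, by simpa [aeval_eq_eval] using hp, fun q hqp => by
    simpa [aeval_eq_eval] using hq q q.2 (Subtype.coe_ne_coe.2 hqp)⟩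

theorem mem_projIdeal_iff {S : Set (DualPlane K)} {g : MvPolynomial (Fin 3) K} :
    g ∈ projIdeal S ↔
      ∀ (v : Fin 3 → K) (hv : v ≠ 0), Projectivization.mk K v hv ∈ S → eval v g = 0 := by
  rw [projIdeal, mem_vanishingIdeal_iff]
  exact ⟨fun h v hv hS => h v ⟨hv, hS⟩, fun h v ⟨hv, hS⟩ => h v hv hS⟩

theorem eval_rep_mk_eq_zero_iff {σ : Type*} {g : MvPolynomial σ K} {n : ℕ}
    (hg : g.IsHomogeneous n) {v : σ → K} (hv : v ≠ 0) :
    eval (Projectivization.mk K v hv).rep g = 0 ↔ eval v g = 0 := by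
  obtain ⟨a, ha⟩ := Projectivization.exists_smul_eq_mk_rep K v hv
  rw [← ha, Units.smul_def, eval_smul_of_isHomogeneous hg]
  simp

theorem mem_projIdeal_iff_of_isHomogeneous {S : Set (DualPlane K)} {g : MvPolynomial (Fin 3) K}
    {n : ℕ} (hg : g.IsHomogeneous n) : g ∈ projIdeal S ↔ ∀ ℓ ∈ S, eval ℓ.rep g = 0 := by
  rw [mem_projIdeal_iff]
  exact ⟨fun h ℓ hℓ => h ℓ.rep ℓ.rep_nonzero (by rwa [ℓ.mk_rep]),
    fun h v hv hS => (eval_rep_mk_eq_zero_iff hg hv).1 (h _ hS)⟩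

theorem homogeneousComponent_mem_projIdeal [Infinite K] {S : Set (DualPlane K)}
    {g : MvPolynomial (Fin 3) K} (hg : g ∈ projIdeal S) (k : ℕ) :
    homogeneousComponent k g ∈ projIdeal S := by
  rw [mem_projIdeal_iff] at hg ⊢
  intro v hv hS
  have dilate_eq_zero : (dilate g).map (eval v) = 0 := by
    refine Polynomial.eq_zero_of_infinite_isRoot _
      ((Set.finite_singleton (0 : K)).infinite_compl.mono fun c (hc : c ≠ 0) => ?_)
    rw [Set.mem_ofPred_eq, Polynomial.IsRoot, eval_map_dilate]
    refine hg _ (smul_ne_zero hc hv) ?_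
    rwa [(Projectivization.mk_eq_mk_iff' K _ _ _ hv).2 ⟨c, rfl⟩]
  rw [← coeff_dilate, ← Polynomial.coeff_map, dilate_eq_zero, Polynomial.coeff_zero]

/-- No point of `S` is isolated, in the weak sense that every form that does not vanish at some
point of `S` does not vanish at infinitely many points of `S`. -/
def HasNoIsolatedPoint (S : Set (DualPlane K)) : Prop :=
  ∀ (n : ℕ) (q : MvPolynomial (Fin 3) K), q.IsHomogeneous n → ∀ ℓ ∈ S, eval ℓ.rep q ≠ 0 →
    {m | m ∈ S ∧ eval m.rep q ≠ 0}.Infinite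

theorem exists_isHomogeneous_mem_projIdeal [Infinite K] {S : Set (DualPlane K)}
    (h : projIdeal S ≠ ⊥) :
    ∃ (n : ℕ) (g : MvPolynomial (Fin 3) K), g ≠ 0 ∧ g.IsHomogeneous n ∧ g ∈ projIdeal S := by
  obtain ⟨g, hg, hg0⟩ := Submodule.exists_mem_ne_zero_of_ne_bot h
  obtain ⟨k, hk⟩ : ∃ k, homogeneousComponent k g ≠ 0 := by
    by_contra! hk
    exact hg0 (by rw [← sum_homogeneousComponent g, Finset.sum_eq_zero fun k _ => hk k])
  exact ⟨k, _, hk, homogeneousComponent_isHomogeneous k g, homogeneousComponent_mem_projIdeal hg k⟩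

theorem HasNoIsolatedPoint.mem_projIdeal_of_mul_mem {S : Set (DualPlane K)}
    (hS : HasNoIsolatedPoint S) {a b c : MvPolynomial (Fin 3) K} {i j k : ℕ} (ha0 : a ≠ 0)
    (hb0 : b ≠ 0) (ha : a.IsHomogeneous i) (hb : b.IsHomogeneous j) (hc : c.IsHomogeneous k)
    (hab : IsRelPrime a b) (hca : c * a ∈ projIdeal S) (hcb : c * b ∈ projIdeal S) :
    c ∈ projIdeal S := by
  rw [mem_projIdeal_iff_of_isHomogeneous hc]
  by_contra! h
  obtain ⟨ℓ, hℓ, hcℓ⟩ := h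
  refine hS k c hc ℓ hℓ hcℓ (Set.Finite.subset (Set.finite_of_encard_le_coe
    (encard_projective_commonZeros_le ha0 hb0 ha hb hab)) ?_)
  rintro m ⟨hm, hcm⟩
  have hcam := (mem_projIdeal_iff_of_isHomogeneous (hc.mul ha)).1 hca m hm
  have hcbm := (mem_projIdeal_iff_of_isHomogeneous (hc.mul hb)).1 hcb m hm
  rw [map_mul] at hcam hcbm
  exact ⟨(mul_eq_zero.1 hcam).resolve_left hcm, (mul_eq_zero.1 hcbm).resolve_left hcm⟩

theorem HasNoIsolatedPoint.dvd_of_minimal_degree {S : Set (DualPlane K)}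
    (hS : HasNoIsolatedPoint S) {g h : MvPolynomial (Fin 3) K} {n k : ℕ} (hh0 : h ≠ 0)
    (hh : h.IsHomogeneous n) (hhS : h ∈ projIdeal S)
    (hmin : ∀ m < n, ∀ c : MvPolynomial (Fin 3) K, c ≠ 0 → c.IsHomogeneous m → c ∉ projIdeal S)
    (hg : g.IsHomogeneous k) (hgS : g ∈ projIdeal S) : h ∣ g := by
  rcases eq_or_ne g 0 with rfl | hg0
  · exact dvd_zero h
  obtain ⟨a, b, c, hab, rfl, rfl⟩ := UniqueFactorizationMonoid.exists_reduced_factors h hh0 g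
  obtain ⟨i, j, rfl, hc, ha⟩ := isHomogeneous_of_mul hh hh0
  obtain ⟨_, _, _, _, hb⟩ := isHomogeneous_of_mul hg hg0
  have ha0 := right_ne_zero_of_mul hh0
  have hcS := hS.mem_projIdeal_of_mul_mem ha0 (right_ne_zero_of_mul hg0) ha hb hc hab hhS hgS
  have hj : j = 0 := by
    by_contra hj
    exact hmin i (by omega) c (left_ne_zero_of_mul hh0) hc hcS
  have ha_unit : IsUnit a := by
    have ha_const := totalDegree_eq_zero_iff_eq_C.1 ((ha.totalDegree ha0).trans hj)
    rw [ha_const] at ha0 ⊢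
    exact (IsUnit.mk0 _ (by simpa only [ne_eq, C_eq_zero] using ha0)).map C
  exact mul_dvd_mul_left c ha_unit.dvd

theorem HasNoIsolatedPoint.exists_hasDegree [Infinite K] {S : Set (DualPlane K)}
    (hS : HasNoIsolatedPoint S) (h0 : projIdeal S ≠ ⊥) : ∃ n, HasDegree S n := by
  classical
  have h_exists := exists_isHomogeneous_mem_projIdeal h0
  obtain ⟨h, hh0, hh, hhS⟩ := Nat.find_spec h_exists
  refine ⟨_, h, hh0, hh, le_antisymm (fun g hg => ?_) (by rwa [Ideal.span_singleton_le_iff_mem])⟩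
  rw [← sum_homogeneousComponent g]
  refine sum_mem fun k _ => Ideal.mem_span_singleton.2 ?_
  exact hS.dvd_of_minimal_degree hh0 hh hhS
    (fun m hm c hc0 hc hcS => Nat.find_min h_exists hm ⟨c, hc0, hc, hcS⟩)
    (homogeneousComponent_isHomogeneous k g) (homogeneousComponent_mem_projIdeal hg k)

theorem mem_projClosure_iff {S : Set (DualPlane K)} {h : MvPolynomial (Fin 3) K}
    (hI : projIdeal S = Ideal.span {h}) {ℓ : DualPlane K} :
    ℓ ∈ projClosure S ↔ eval ℓ.rep h = 0 := by
  refine ⟨fun hℓ => hℓ h (hI ▸ Ideal.mem_span_singleton_self h), fun hℓ g hg => ?_⟩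
  rw [hI, Ideal.mem_span_singleton] at hg
  obtain ⟨r, rfl⟩ := hg
  rw [map_mul, hℓ, zero_mul]

theorem subset_projClosure (S : Set (DualPlane K)) : S ⊆ projClosure S := fun ℓ hℓ _ hg =>
  mem_projIdeal_iff.1 hg ℓ.rep ℓ.rep_nonzero (by rwa [ℓ.mk_rep])

end ProjIdeal

/-! ### The image of a plane curve under a polynomial map -/

section Image

variable {K : Type*} [Field K]

theorem totalDegree_pderiv_le {σ : Type*} (i : σ) (f : MvPolynomial σ K) :
    (pderiv i f).totalDegree ≤ f.totalDegree - 1 := by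
  conv_lhs => rw [← sum_homogeneousComponent f, map_sum]
  refine totalDegree_finsetSum_le fun k hk => ?_
  have hk := Finset.mem_range.1 hk
  exact (homogeneousComponent_isHomogeneous k f).pderiv.totalDegree_le.trans (by omega)

theorem totalDegree_aeval_le {σ τ : Type*} {ν : σ → MvPolynomial τ K} {m e : ℕ}
    (hν : ∀ i, (ν i).totalDegree ≤ m) {g : MvPolynomial σ K} (hg : g.totalDegree ≤ e) :
    (aeval ν g).totalDegree ≤ m * e := by
  rw [aeval_def, eval₂_eq]
  refine totalDegree_finsetSum_le fun s hs => ?_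
  calc (algebraMap K (MvPolynomial τ K) (coeff s g) * ∏ i ∈ s.support, ν i ^ s i).totalDegree
      ≤ 0 + (∏ i ∈ s.support, ν i ^ s i).totalDegree :=
        (totalDegree_mul _ _).trans_eq (congrArg (· + _) (totalDegree_C _))
    _ ≤ ∑ i ∈ s.support, (ν i ^ s i).totalDegree := by
        rw [zero_add]
        exact totalDegree_finsetProd _ _
    _ ≤ ∑ i ∈ s.support, m * s i := Finset.sum_le_sum fun i _ =>
        (totalDegree_pow _ _).trans (by rw [mul_comm m]; exact Nat.mul_le_mul_left _ (hν i))
    _ = m * ∑ i ∈ s.support, s i := by rw [Finset.mul_sum]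
    _ ≤ m * e := Nat.mul_le_mul_left _ ((le_totalDegree hs).trans hg)

variable {f : MvPolynomial (Fin 2) K} {ν : Fin 3 → MvPolynomial (Fin 2) K} {m : ℕ}

/-- The polynomials whose pullback under the polynomial map `ν` is a multiple of `f`: these are
equations of the image of the curve `f = 0`. -/
def imageIdeal (f : MvPolynomial (Fin 2) K) (ν : Fin 3 → MvPolynomial (Fin 2) K) :
    Ideal (MvPolynomial (Fin 3) K) :=
  (Ideal.span {f}).comap (aeval ν)

theorem mem_imageIdeal_iff {g : MvPolynomial (Fin 3) K} : g ∈ imageIdeal f ν ↔ f ∣ aeval ν g :=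
  Ideal.mem_span_singleton

theorem finrank_forms_le (hf : f ≠ 0) (hν : ∀ i, (ν i).totalDegree ≤ m) {e k : ℕ}
    (he : k + f.totalDegree = m * e) :
    (e + 1) * (e + 2) + (k + 1) * (k + 2) ≤
      (k + f.totalDegree + 1) * (k + f.totalDegree + 2) +
        2 * Module.finrank K ((homogeneousSubmodule (Fin 3) K e ⊓
          (imageIdeal f ν).restrictScalars K : Submodule K _)) := by
  have h_forms : (homogeneousSubmodule (Fin 3) K e).map (aeval ν).toLinearMap ≤
      restrictTotalDegree (Fin 2) K (k + f.totalDegree) := by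
    rw [Submodule.map_le_iff_le_comap]
    intro g (hg : g.IsHomogeneous e)
    rw [he, Submodule.mem_comap, mem_restrictTotalDegree]
    exact totalDegree_aeval_le hν hg.totalDegree_le
  have h_multiples : (restrictTotalDegree (Fin 2) K k).map (LinearMap.mulLeft K f) ≤
      restrictTotalDegree (Fin 2) K (k + f.totalDegree) := by
    rw [Submodule.map_le_iff_le_comap]
    exact fun a ha => (hasFiltrationDegree_totalDegree hf k a).2 ha
  have h := finrank_add_finrank_le_of_map_le h_forms h_multiples
  have h_kernel := Submodule.finrank_mono (R := K)
    (s := homogeneousSubmodule (Fin 3) K e ⊓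
      ((restrictTotalDegree (Fin 2) K k).map (LinearMap.mulLeft K f)).comap (aeval ν).toLinearMap)
    (t := homogeneousSubmodule (Fin 3) K e ⊓ (imageIdeal f ν).restrictScalars K)
    (inf_le_inf_left _ fun g ⟨r, _, hr⟩ => mem_imageIdeal_iff.2 ⟨r, hr.symm⟩)
  simp only [finrank_map_mulLeft hf, finrank_homogeneousSubmodule, finrank_restrictTotalDegree,
    Fintype.card_fin, Nat.reduceAdd] at h
  have := two_mul_multichoose_three e
  have := two_mul_multichoose_three k
  have := two_mul_multichoose_three (k + f.totalDegree)
  omega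

theorem exists_isHomogeneous_mem_imageIdeal (hf : f ≠ 0) (ν : Fin 3 → MvPolynomial (Fin 2) K) :
    ∃ (n : ℕ) (g : MvPolynomial (Fin 3) K), g ≠ 0 ∧ g.IsHomogeneous n ∧ g ∈ imageIdeal f ν := by
  by_contra! h
  obtain ⟨m, hm, hν⟩ : ∃ m, 1 ≤ m ∧ ∀ i, (ν i).totalDegree ≤ m := by
    refine ⟨1 + ∑ i, (ν i).totalDegree, by omega, fun i => ?_⟩
    exact (Finset.single_le_sum_of_canonicallyOrdered (f := fun i => (ν i).totalDegree)
      (Finset.mem_univ i)).trans (Nat.le_add_left _ _)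
  have forms_eq_bot (e : ℕ) :
      homogeneousSubmodule (Fin 3) K e ⊓ (imageIdeal f ν).restrictScalars K = ⊥ := by
    rw [eq_bot_iff]
    rintro g ⟨hg, hgJ⟩
    by_contra hg0
    exact h e g hg0 hg hgJ
  set d := f.totalDegree
  obtain ⟨k, hk⟩ : ∃ k, k + d = m * (2 * d * m + 3 * d) :=
    ⟨m * (2 * d * m + 3 * d) - d, Nat.sub_add_cancel (by nlinarith [Nat.zero_le (m * m * d)])⟩
  have h_le := finrank_forms_le hf hν hk
  rw [forms_eq_bot, finrank_bot] at h_le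
  nlinarith [Nat.zero_le (d * d), Nat.zero_le (d * m)]

theorem degree_le_of_forall_mem_imageIdeal_dvd (hf : f ≠ 0) (hm : 1 ≤ m)
    (hν : ∀ i, (ν i).totalDegree ≤ m) {h : MvPolynomial (Fin 3) K} {n : ℕ} (h0 : h ≠ 0)
    (hn : h.IsHomogeneous n)
    (hJ : ∀ e g, g.IsHomogeneous e → g ∈ imageIdeal f ν → h ∣ g) :
    n ≤ f.totalDegree * m := by
  by_contra! hlt
  set d := f.totalDegree with hd
  obtain ⟨k, hk⟩ : ∃ k, k + d = m * (d * m * n + 2 * d + n) :=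
    ⟨m * (d * m * n + 2 * d + n) - d,
      Nat.sub_add_cancel (by nlinarith [Nat.zero_le (d * m * n), Nat.zero_le n])⟩
  set s := d * m * n + 2 * d with hs
  have forms_le : homogeneousSubmodule (Fin 3) K (s + n) ⊓ (imageIdeal f ν).restrictScalars K ≤
      (homogeneousSubmodule (Fin 3) K s).map (LinearMap.mulLeft K h) := by
    rintro g ⟨hg, hgJ⟩
    obtain ⟨r, rfl⟩ := hJ _ g hg hgJ
    exact ⟨r, (hasFiltrationDegree_of_isHomogeneous hn h0 s r).1 hg, rfl⟩
  have h_le := finrank_forms_le hf hν hk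
  rw [← hd] at h_le
  have h_forms := Submodule.finrank_mono (R := K) forms_le
  rw [finrank_map_mulLeft h0, finrank_homogeneousSubmodule, Fintype.card_fin] at h_forms
  have h_dim := two_mul_multichoose_three s
  have h_count : (s + n + 1) * (s + n + 2) + (k + 1) * (k + 2) ≤
      (k + d + 1) * (k + d + 2) + (s + 1) * (s + 2) := by omega
  have h_quadratic : n * (2 * s + n + 3) + d * d ≤ 2 * d * m * (s + n) + 3 * d := by
    nlinarith [h_count, congrArg (d * ·) hk]
  nlinarith [Nat.mul_le_mul_right s hlt, Nat.zero_le (d * d), Nat.zero_le (n * n)]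

end Image

section CurveOfNormals

variable {K : Type*} [Field K]

/-- The polynomial map that sends a point to the coefficients of the normal at that point. -/
def normalPoly (f : MvPolynomial (Fin 2) K) : Fin 3 → MvPolynomial (Fin 2) K :=
  ![pderiv 1 f, - pderiv 0 f, X 1 * pderiv 0 f - X 0 * pderiv 1 f]

theorem eval_normalPoly (f : MvPolynomial (Fin 2) K) (p : Fin 2 → K) (i : Fin 3) :
    eval p (normalPoly f i) = normalVector f p i := by
  fin_cases i <;> simp [normalPoly, normalVector]

theorem totalDegree_normalPoly_le {f : MvPolynomial (Fin 2) K} (hf : 1 ≤ f.totalDegree)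
    (i : Fin 3) : (normalPoly f i).totalDegree ≤ f.totalDegree := by
  have h_mul (j k : Fin 2) : (X j * pderiv k f).totalDegree ≤ f.totalDegree := by
    have := totalDegree_pderiv_le k f
    refine (totalDegree_mul _ _).trans ?_
    rw [totalDegree_X]
    omega
  fin_cases i
  · exact (totalDegree_pderiv_le _ _).trans (Nat.sub_le _ _)
  · exact (totalDegree_neg _).trans_le ((totalDegree_pderiv_le _ _).trans (Nat.sub_le _ _))
  · exact (totalDegree_sub _ _).trans (max_le (h_mul 1 0) (h_mul 0 1))

theorem mem_projIdeal_of_mem_imageIdeal {f : MvPolynomial (Fin 2) K} {g : MvPolynomial (Fin 3) K}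
    {n : ℕ} (hg : g.IsHomogeneous n) (hgJ : g ∈ imageIdeal f (normalPoly f)) :
    g ∈ projIdeal (curveOfNormals f) := by
  rw [mem_projIdeal_iff_of_isHomogeneous hg]
  rintro ℓ ⟨p, hp, hn, rfl⟩
  obtain ⟨r, hr⟩ := mem_imageIdeal_iff.1 hgJ
  rw [eval_rep_mk_eq_zero_iff hg, ← funext (eval_normalPoly f p), ← eval_aeval, hr, map_mul, hp,
    zero_mul]

theorem projIdeal_curveOfNormals_ne_bot {f : MvPolynomial (Fin 2) K} (hf : f ≠ 0) :
    projIdeal (curveOfNormals f) ≠ ⊥ := by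
  obtain ⟨n, g, hg0, hg, hgJ⟩ := exists_isHomogeneous_mem_imageIdeal hf (normalPoly f)
  exact Submodule.ne_bot_iff _ |>.2 ⟨g, mem_projIdeal_of_mem_imageIdeal hg hgJ, hg0⟩

theorem HasDegree.le_totalDegree_sq {f : MvPolynomial (Fin 2) K} (hf : 1 ≤ f.totalDegree) {n : ℕ}
    (hn : HasDegree (curveOfNormals f) n) : n ≤ f.totalDegree ^ 2 := by
  obtain ⟨h, h0, hhom, hI⟩ := hn
  have hf0 : f ≠ 0 := by rintro rfl; simp at hf
  rw [sq]
  refine degree_le_of_forall_mem_imageIdeal_dvd hf0 hf (totalDegree_normalPoly_le hf) h0 hhom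
    fun e g hg hgJ => ?_
  rw [← Ideal.mem_span_singleton, ← hI]
  exact mem_projIdeal_of_mem_imageIdeal hg hgJ

end CurveOfNormals

/-! ### Intersection of a plane curve with a pencil -/

section RestrictLine

variable {σ K : Type*} [Field K]

/-- The restriction of a polynomial to the parametrized line `s ↦ a + s • b`. -/
def restrictLine (a b : σ → K) : MvPolynomial σ K →ₐ[K] Polynomial K :=
  aeval fun i => Polynomial.C (a i) + Polynomial.X * Polynomial.C (b i)

theorem eval_restrictLine (a b : σ → K) (g : MvPolynomial σ K) (s : K) :
    (restrictLine a b g).eval s = eval (a + s • b) g := by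
  induction g using MvPolynomial.induction_on with
  | C r => simp [restrictLine]
  | add p q hp hq => simp [hp, hq]
  | mul_X p i hp =>
    rw [map_mul, Polynomial.eval_mul, hp]
    simp [restrictLine, mul_comm (b i)]

theorem natDegree_restrictLine_le (a b : σ → K) (g : MvPolynomial σ K) :
    (restrictLine a b g).natDegree ≤ g.totalDegree := by
  have := aeval_natDegree_le g le_rfl
    (fun i => Polynomial.C (a i) + Polynomial.X * Polynomial.C (b i)) (n := 1) fun i => by
      compute_degree
  simpa [restrictLine] using this

theorem eval_derivative_restrictLine [Fintype σ] (a b : σ → K) (g : MvPolynomial σ K) (s : K) :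
    (restrictLine a b g).derivative.eval s = ∑ i, eval (a + s • b) (pderiv i g) * b i := by
  classical
  induction g using MvPolynomial.induction_on with
  | C r => simp [restrictLine]
  | add p q hp hq => simp [hp, hq, add_mul, Finset.sum_add_distrib]
  | mul_X p j hp =>
    have derivative_X : (restrictLine a b (X j)).derivative = Polynomial.C (b j) := by
      simp [restrictLine]
    have h_single : ∑ i, eval (a + s • b) p * (eval (a + s • b) (pderiv i (X j)) * b i) =
        eval (a + s • b) p * b j := by
      simp [pderiv_X, Pi.single_apply, apply_ite]
    rw [map_mul, Polynomial.derivative_mul, derivative_X, Polynomial.eval_add, Polynomial.eval_mul,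
      Polynomial.eval_mul, Polynomial.eval_C, eval_restrictLine, eval_restrictLine, hp,
      ← h_single, Finset.sum_mul, ← Finset.sum_add_distrib]
    refine Finset.sum_congr rfl fun i _ => ?_
    rw [Derivation.leibniz, smul_eq_mul, smul_eq_mul, map_add, map_mul, map_mul]
    ring

theorem restrictLine_ne_zero_of_eval_ne_zero [Infinite K] {h : MvPolynomial σ K} {n : ℕ}
    (hn : h.IsHomogeneous n) (a : σ → K) {b : σ → K} (hb : eval b h ≠ 0) :
    restrictLine a b h ≠ 0 := by
  intro h0
  have h_swap : restrictLine b a h = 0 := by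
    refine Polynomial.eq_zero_of_infinite_isRoot _
      ((Set.finite_singleton (0 : K)).infinite_compl.mono fun t (ht : t ≠ 0) => ?_)
    have h_smul : b + t • a = t • (a + t⁻¹ • b) := by
      rw [smul_add, smul_smul, mul_inv_cancel₀ ht, one_smul, add_comm]
    rw [Set.mem_ofPred_eq, Polynomial.IsRoot, eval_restrictLine, h_smul,
      eval_smul_of_isHomogeneous hn, ← eval_restrictLine, h0, Polynomial.eval_zero, mul_zero]
  refine hb ?_
  rw [← add_zero b, ← zero_smul K a, ← eval_restrictLine, h_swap, Polynomial.eval_zero]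

theorem eval_derivative_ne_zero_of_natDegree_le_card_roots [DecidableEq K] {P : Polynomial K}
    (hP : P.natDegree ≤ P.roots.toFinset.card) (hP0 : P ≠ 0) {x : K} (hx : P.IsRoot x) :
    P.derivative.eval x ≠ 0 := fun h_derivative => by
  have h_multiple := (Polynomial.one_lt_rootMultiplicity_iff_isRoot hP0).2 ⟨hx, h_derivative⟩
  have h_nodup : P.roots.Nodup := by
    rw [← Multiset.toFinset_card_eq_card_iff_nodup]
    exact le_antisymm (Multiset.toFinset_card_le _) ((Polynomial.card_roots' _).trans hP)
  have h_count := Multiset.nodup_iff_count_le_one.1 h_nodup x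
  rw [Polynomial.count_roots] at h_count
  omega

end RestrictLine

section Pencil

variable {K : Type*} [Field K]

theorem mem_pencil_iff {w : ℙ K (Fin 3 → K)} {ℓ : DualPlane K} :
    ℓ ∈ pencil w ↔ ℓ.rep ⬝ᵥ w.rep = 0 := by
  rw [← Projectivization.orthogonal_mk ℓ.rep_nonzero w.rep_nonzero, ℓ.mk_rep, w.mk_rep]
  rfl

theorem pencil_nonempty (w : ℙ K (Fin 3 → K)) : (pencil w).Nonempty := by
  obtain ⟨v, hv, hvw⟩ := exists_ne_zero_dotProduct_eq_zero w.rep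
  refine ⟨Projectivization.mk K v hv, ?_⟩
  rwa [← Projectivization.orthogonal_mk hv w.rep_nonzero, w.mk_rep] at hvw

theorem mem_span_pair_of_dotProduct_eq_zero {w a u m : Fin 3 → K} (hw : w ≠ 0)
    (hau : LinearIndependent K ![a, u]) (ha : a ⬝ᵥ w = 0) (hu : u ⬝ᵥ w = 0) (hm : m ⬝ᵥ w = 0) :
    m ∈ Submodule.span K {a, u} := by
  let φ : Module.Dual K (Fin 3 → K) := dotProductBilin K K w
  have mem_ker {v : Fin 3 → K} (hv : v ⬝ᵥ w = 0) : v ∈ φ.ker := by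
    rw [LinearMap.mem_ker, ← hv, dotProduct_comm]
    rfl
  have hφ : φ ≠ 0 := fun h => hw (dotProduct_eq_zero w fun v => LinearMap.congr_fun h v)
  have h_ker := Module.Dual.finrank_ker_add_one_of_ne_zero hφ
  have h_span := finrank_span_eq_card hau
  rw [Matrix.range_cons_cons_empty] at h_span
  have h_eq : Submodule.span K {a, u} = φ.ker := by
    refine Submodule.eq_of_le_of_finrank_eq ?_ ?_
    · rw [Submodule.span_le, Set.pair_subset_iff]
      exact ⟨mem_ker ha, mem_ker hu⟩
    · rw [Module.finrank_fin_fun] at h_ker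
      rw [h_span, Fintype.card_fin]
      omega
  exact h_eq ▸ mem_ker hm

variable {S : Set (DualPlane K)} {h : MvPolynomial (Fin 3) K} {n : ℕ}

theorem exists_rep_eq_smul_add_smul (hn : h.IsHomogeneous n) {w : ℙ K (Fin 3 → K)}
    {u : Fin 3 → K} (huw : u ⬝ᵥ w.rep = 0) (hu : eval u h ≠ 0) {ℓ m : DualPlane K}
    (hℓw : ℓ ∈ pencil w) (hℓ : eval ℓ.rep h = 0) (hmw : m ∈ pencil w) (hm : eval m.rep h = 0) :
    ∃ s c : K, c ≠ 0 ∧ m.rep = c • (ℓ.rep + s • u) := by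
  have h_independent : LinearIndependent K ![ℓ.rep, u] := by
    rw [LinearIndependent.pair_iff' ℓ.rep_nonzero]
    rintro b rfl
    rw [eval_smul_of_isHomogeneous hn, hℓ, mul_zero] at hu
    exact hu rfl
  obtain ⟨c, b, hcb⟩ := Submodule.mem_span_pair.1 (mem_span_pair_of_dotProduct_eq_zero
    w.rep_nonzero h_independent (mem_pencil_iff.1 hℓw) huw (mem_pencil_iff.1 hmw))
  have hc : c ≠ 0 := by
    rintro rfl
    rw [zero_smul, zero_add] at hcb
    rw [← hcb, eval_smul_of_isHomogeneous hn] at hm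
    have hb := eq_zero_of_pow_eq_zero ((mul_eq_zero.1 hm).resolve_right hu)
    exact m.rep_nonzero (by rw [← hcb, hb, zero_smul])
  exact ⟨c⁻¹ * b, c, hc, by rw [← hcb, smul_add, smul_smul, mul_inv_cancel_left₀ hc]⟩

variable [Infinite K]

theorem encard_projClosure_inter_pencil_le_card_roots [DecidableEq K] (hn : h.IsHomogeneous n)
    (hI : projIdeal S = Ideal.span {h}) {w : ℙ K (Fin 3 → K)} {u : Fin 3 → K}
    (huw : u ⬝ᵥ w.rep = 0) (hu : eval u h ≠ 0) {ℓ : DualPlane K}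
    (hℓ : ℓ ∈ projClosure S ∩ pencil w) :
    (projClosure S ∩ pencil w).encard ≤ (restrictLine ℓ.rep u h).roots.toFinset.card := by
  choose! r c hc hr using fun m (hm : m ∈ projClosure S ∩ pencil w) =>
    exists_rep_eq_smul_add_smul hn huw hu hℓ.2 ((mem_projClosure_iff hI).1 hℓ.1) hm.2
      ((mem_projClosure_iff hI).1 hm.1)
  have r_injOn : Set.InjOn r (projClosure S ∩ pencil w) := by
    intro m hm m' hm' hmm
    rw [← m.mk_rep, ← m'.mk_rep, Projectivization.mk_eq_mk_iff']
    refine ⟨c m * (c m')⁻¹, ?_⟩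
    rw [hr m' hm', hr m hm, hmm, smul_smul, mul_assoc, inv_mul_cancel₀ (hc m' hm'), mul_one]
  rw [← r_injOn.encard_image, ← Set.encard_coe_eq_coe_finsetCard]
  refine Set.encard_le_encard ?_
  rintro _ ⟨m, hm, rfl⟩
  have hm_zero := (mem_projClosure_iff hI).1 hm.1
  rw [hr m hm, eval_smul_of_isHomogeneous hn, ← eval_restrictLine] at hm_zero
  rw [Finset.mem_coe, Multiset.mem_toFinset,
    Polynomial.mem_roots (restrictLine_ne_zero_of_eval_ne_zero hn _ hu)]
  exact (mul_eq_zero.1 hm_zero).resolve_left (pow_ne_zero _ (hc m hm))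

theorem encard_projClosure_inter_pencil_le (hn : h.IsHomogeneous n)
    (hI : projIdeal S = Ideal.span {h}) {w : ℙ K (Fin 3 → K)} {u : Fin 3 → K}
    (huw : u ⬝ᵥ w.rep = 0) (hu : eval u h ≠ 0) :
    (projClosure S ∩ pencil w).encard ≤ n := by
  classical
  rcases (projClosure S ∩ pencil w).eq_empty_or_nonempty with h_empty | ⟨ℓ, hℓ⟩
  · simp [h_empty]
  refine (encard_projClosure_inter_pencil_le_card_roots hn hI huw hu hℓ).trans (Nat.cast_le.2 ?_)
  calc (restrictLine ℓ.rep u h).roots.toFinset.card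
      ≤ (restrictLine ℓ.rep u h).natDegree :=
        (Multiset.toFinset_card_le _).trans (Polynomial.card_roots' _)
    _ ≤ h.totalDegree := natDegree_restrictLine_le _ _ _
    _ ≤ n := hn.totalDegree_le

theorem meetsTransversally_of_encard_eq (hn : h.IsHomogeneous n)
    (hI : projIdeal S = Ideal.span {h}) {w : ℙ K (Fin 3 → K)} {u : Fin 3 → K}
    (huw : u ⬝ᵥ w.rep = 0) (hu : eval u h ≠ 0) (hcard : (projClosure S ∩ pencil w).encard = n) :
    MeetsTransversally w S := by
  classical
  intro ℓ hℓ
  refine ⟨h, hI ▸ Ideal.mem_span_singleton_self h, u, huw, ?_⟩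
  have h_roots := encard_projClosure_inter_pencil_le_card_roots hn hI huw hu hℓ
  rw [hcard, Nat.cast_le] at h_roots
  have h_degree := (natDegree_restrictLine_le ℓ.rep u h).trans hn.totalDegree_le
  have h_simple := eval_derivative_ne_zero_of_natDegree_le_card_roots (x := 0)
    (h_degree.trans h_roots) (restrictLine_ne_zero_of_eval_ne_zero hn _ hu) (by
      rw [Polynomial.IsRoot, eval_restrictLine, zero_smul, add_zero]
      exact (mem_projClosure_iff hI).1 hℓ.1)
  rwa [eval_derivative_restrictLine, zero_smul, add_zero] at h_simple

theorem MeetsTransversally.exists_eval_ne_zero (hI : projIdeal S = Ideal.span {h})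
    {w : ℙ K (Fin 3 → K)} (hw : MeetsTransversally w S) :
    ∃ u : Fin 3 → K, u ⬝ᵥ w.rep = 0 ∧ eval u h ≠ 0 := by
  by_contra! h_vanish
  obtain ⟨ℓ, hℓ⟩ := pencil_nonempty w
  have hℓw := mem_pencil_iff.1 hℓ
  obtain ⟨g, hg, t, htw, ht⟩ := hw ℓ ⟨(mem_projClosure_iff hI).2 (h_vanish _ hℓw), hℓ⟩
  obtain ⟨r, rfl⟩ := Ideal.mem_span_singleton.1 (hI ▸ hg)
  have restrict_eq_zero : restrictLine ℓ.rep t (h * r) = 0 := by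
    refine Polynomial.funext fun s => ?_
    rw [eval_restrictLine, map_mul, h_vanish, zero_mul, Polynomial.eval_zero]
    rw [add_dotProduct, smul_dotProduct, hℓw, htw, smul_zero, add_zero]
  refine ht ?_
  rw [← add_zero ℓ.rep, ← zero_smul K t, ← eval_derivative_restrictLine,
    restrict_eq_zero, Polynomial.derivative_zero, Polynomial.eval_zero]

theorem HasNoIsolatedPoint.exists_eval_ne_zero (hS : HasNoIsolatedPoint S) (h0 : h ≠ 0)
    (hn : h.IsHomogeneous n) (hI : projIdeal S = Ideal.span {h}) {w : ℙ K (Fin 3 → K)}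
    (hfin : (S ∩ pencil w).Finite) :
    ∃ u : Fin 3 → K, u ⬝ᵥ w.rep = 0 ∧ eval u h ≠ 0 := by
  by_contra! h_vanish
  have h_mem : h ∈ projIdeal S := hI ▸ Ideal.mem_span_singleton_self h
  obtain ⟨g, rfl⟩ := linForm_dvd_of_forall_eval_eq_zero w.rep_nonzero h_vanish
  obtain ⟨i, j, hij, hi, hg⟩ := isHomogeneous_of_mul hn h0
  have hg0 := right_ne_zero_of_mul h0
  have hi_one := hi.inj_right (isHomogeneous_linForm w.rep) (left_ne_zero_of_mul h0)
  have hgS : g ∉ projIdeal S := by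
    rw [hI, Ideal.mem_span_singleton]
    intro h_dvd
    have h_degree := totalDegree_le_of_dvd_of_isDomain h_dvd hg0
    rw [hn.totalDegree h0, hg.totalDegree hg0] at h_degree
    omega
  rw [mem_projIdeal_iff_of_isHomogeneous hg] at hgS
  push Not at hgS
  obtain ⟨ℓ, hℓ, hgℓ⟩ := hgS
  refine hS j g hg ℓ hℓ hgℓ (hfin.subset fun m ⟨hmS, hgm⟩ => ⟨hmS, mem_pencil_iff.2 ?_⟩)
  have h_zero := (mem_projIdeal_iff_of_isHomogeneous hn).1 h_mem m hmS
  rw [map_mul, eval_linForm] at h_zero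
  exact (mul_eq_zero.1 h_zero).resolve_right hgm

end Pencil

/-! ### Normals and gradients -/

section Gradient

variable {K : Type*} [Field K]

/-- The gradient of `f` at the point `p`. -/
def grad {σ : Type*} (f : MvPolynomial σ K) (p : σ → K) : σ → K :=
  fun i => eval p (pderiv i f)

/-- The determinant of two vectors of the plane. -/
def wedge (u v : Fin 2 → K) : K :=
  u 0 * v 1 - u 1 * v 0

theorem wedge_self (u : Fin 2 → K) : wedge u u = 0 := by
  simp [wedge, mul_comm]

theorem wedge_swap (u v : Fin 2 → K) : wedge v u = -wedge u v := by
  simp only [wedge]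
  ring

theorem exists_wedge_ne_zero {u : Fin 2 → K} (hu : u ≠ 0) : ∃ v, wedge u v ≠ 0 := by
  by_contra! h
  have h₀ := h ![0, 1]
  have h₁ := h ![1, 0]
  simp only [wedge, Matrix.cons_val_zero, Matrix.cons_val_one, mul_one, mul_zero, sub_zero,
    zero_sub, neg_eq_zero] at h₀ h₁
  exact hu (by ext i; fin_cases i; exacts [h₀, h₁])

theorem exists_eq_smul_of_wedge_eq_zero {u v : Fin 2 → K} (hv : v ≠ 0) (h : wedge u v = 0) :
    ∃ s : K, u = s • v := by
  obtain ⟨w, hw⟩ := exists_wedge_ne_zero hv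
  refine ⟨wedge u w / wedge v w, ?_⟩
  have h_cramer : wedge v w • u = wedge u w • v := by
    simp only [wedge] at h ⊢
    ext i
    fin_cases i
    · simp only [Fin.zero_eta, Pi.smul_apply, smul_eq_mul]
      linear_combination -w 0 * h
    · simp only [Fin.mk_one, Pi.smul_apply, smul_eq_mul]
      linear_combination -w 1 * h
  rw [div_eq_inv_mul, mul_smul, ← h_cramer, inv_smul_smul₀ hw]

theorem exists_dotProduct_eq_and_dotProduct_eq {a b : Fin 2 → K} (h : wedge a b ≠ 0) (r s : K) :
    ∃ v, a ⬝ᵥ v = r ∧ b ⬝ᵥ v = s := by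
  refine ⟨(wedge a b)⁻¹ • ![r * b 1 - s * a 1, s * a 0 - r * b 0], ?_, ?_⟩ <;>
  · rw [dotProduct_smul, smul_eq_mul, inv_mul_eq_iff_eq_mul₀ h]
    simp only [dotProduct, Fin.sum_univ_two, wedge, Matrix.cons_val_zero, Matrix.cons_val_one]
    ring

theorem normalVector_eq_zero_iff {f : MvPolynomial (Fin 2) K} {p : Fin 2 → K} :
    normalVector f p = 0 ↔ grad f p = 0 := by
  refine ⟨fun h => ?_, fun h => ?_⟩
  · have h₀ : grad f p 0 = 0 := neg_eq_zero.1 (congrFun h 1)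
    have h₁ : grad f p 1 = 0 := congrFun h 0
    ext i
    fin_cases i
    exacts [h₀, h₁]
  · have h₀ : eval p (pderiv 0 f) = 0 := congrFun h 0
    have h₁ : eval p (pderiv 1 f) = 0 := congrFun h 1
    simp [normalVector, h₀, h₁]

theorem normalVector_dotProduct (f : MvPolynomial (Fin 2) K) (p z : Fin 2 → K) :
    normalVector f p ⬝ᵥ ![z 0, z 1, 1] = wedge (z - p) (grad f p) := by
  simp [normalVector, dotProduct, Fin.sum_univ_three, wedge, grad]
  ring

theorem exists_eq_add_smul_grad_of_mk_normalVector_eq {f : MvPolynomial (Fin 2) K}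
    {p q : Fin 2 → K} (hp : normalVector f p ≠ 0) (hq : normalVector f q ≠ 0)
    (h : Projectivization.mk K _ hp = Projectivization.mk K _ hq) :
    ∃ s : K, q = p + s • grad f p := by
  obtain ⟨a, ha⟩ := (Projectivization.mk_eq_mk_iff' ..).1 h
  have h_wedge : wedge (q - p) (grad f p) = 0 := by
    rw [← normalVector_dotProduct, ← ha, smul_dotProduct, normalVector_dotProduct, sub_self]
    simp [wedge]
  obtain ⟨s, hs⟩ := exists_eq_smul_of_wedge_eq_zero (normalVector_eq_zero_iff.not.1 hp) h_wedge
  exact ⟨s, by rw [← hs, add_sub_cancel]⟩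

theorem grad_dotProduct_eq_zero_of_forall_eval_eq_zero [Infinite K] {f : MvPolynomial (Fin 2) K}
    {p v : Fin 2 → K} (h_line : ∀ t : K, eval (p + t • v) f = 0) (t : K) :
    grad f (p + t • v) ⬝ᵥ v = 0 := by
  have restrict_eq_zero : restrictLine p v f = 0 :=
    Polynomial.funext fun t => by rw [eval_restrictLine, h_line, Polynomial.eval_zero]
  rw [← Polynomial.eval_zero (x := t), ← Polynomial.derivative_zero, ← restrict_eq_zero]
  exact (eval_derivative_restrictLine p v f t).symm

end Gradient

section Analysis

variable {K : Type*} [NontriviallyNormedField K]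

/-- The dot product with `a`, as a continuous linear form. -/
def dotProductCLM {σ : Type*} [Fintype σ] (a : σ → K) : (σ → K) →L[K] K :=
  ∑ i, a i • ContinuousLinearMap.proj i

@[simp]
theorem dotProductCLM_apply {σ : Type*} [Fintype σ] (a v : σ → K) :
    dotProductCLM a v = a ⬝ᵥ v := by
  simp [dotProductCLM, dotProduct]

theorem hasStrictFDerivAt_eval {σ : Type*} [Fintype σ] (f : MvPolynomial σ K) (p : σ → K) :
    HasStrictFDerivAt (fun x => eval x f) (dotProductCLM (grad f p)) p := by
  classical
  induction f using MvPolynomial.induction_on with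
  | C r =>
    simp only [eval_C]
    refine (hasStrictFDerivAt_const r p).congr_fderiv ?_
    ext v
    simp [grad, dotProduct]
  | add f g hf hg =>
    simp only [map_add]
    refine (hf.add hg).congr_fderiv ?_
    ext v
    simp [grad, dotProduct, add_mul, Finset.sum_add_distrib]
  | mul_X f j hf =>
    have hX : HasStrictFDerivAt (fun x : σ → K => x j)
        (ContinuousLinearMap.proj j : (σ → K) →L[K] K) p :=
      (ContinuousLinearMap.proj j : (σ → K) →L[K] K).hasStrictFDerivAt
    simp only [map_mul, eval_X]
    refine (hf.mul hX).congr_fderiv ?_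
    ext v
    have h_single : ∑ i, eval p f * (eval p (pderiv i (X j)) * v i) = eval p f * v j := by
      simp [pderiv_X, Pi.single_apply, apply_ite]
    simp only [add_apply, smul_apply, ContinuousLinearMap.proj_apply, dotProductCLM_apply,
      smul_eq_mul, dotProduct, grad, Derivation.leibniz, map_add, map_mul, eval_X, add_mul,
      Finset.sum_add_distrib, h_single, Finset.mul_sum, mul_assoc]

theorem continuous_normalVector (f : MvPolynomial (Fin 2) K) : Continuous (normalVector f) := by
  refine continuous_pi fun i => ?_
  simp only [← eval_normalPoly]
  exact MvPolynomial.continuous_eval _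

variable [CompleteSpace K]

theorem infinite_zeros_of_mem_nhds {f : MvPolynomial (Fin 2) K} {p : Fin 2 → K}
    (hp : eval p f = 0) (h_grad : grad f p ≠ 0) {U : Set (Fin 2 → K)} (hU : U ∈ 𝓝 p) :
    {q ∈ U | eval q f = 0}.Infinite := by
  obtain ⟨b, hb⟩ := exists_wedge_ne_zero h_grad
  have h_deriv :=
    (hasStrictFDerivAt_eval f p).prodMk ((dotProductCLM b).hasStrictFDerivAt (x := p))
  have h_surjective : ((dotProductCLM (grad f p)).prod (dotProductCLM b)).range = ⊤ := by
    rw [LinearMap.range_eq_top]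
    rintro ⟨r, s⟩
    obtain ⟨v, hr, hs⟩ := exists_dotProduct_eq_and_dotProduct_eq hb r s
    exact ⟨v, Prod.ext (by simpa using hr) (by simpa using hs)⟩
  have h_image :
      (fun x => (eval x f, dotProductCLM b x)) '' U ∈ 𝓝 ((0 : K), dotProductCLM b p) := by
    rw [← hp, ← h_deriv.map_nhds_eq_of_surj h_surjective]
    exact image_mem_map hU
  have h_slice : {s | ((0 : K), s) ∈ (fun x => (eval x f, dotProductCLM b x)) '' U}.Infinite :=
    infinite_of_mem_nhds (dotProductCLM b p)
      ((Continuous.prodMk_right (0 : K)).continuousAt h_image)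
  refine Set.Infinite.of_image (dotProductCLM b) (h_slice.mono ?_)
  rintro s ⟨q, hqU, hq⟩
  exact ⟨q, ⟨hqU, congrArg Prod.fst hq⟩, congrArg Prod.snd hq⟩

theorem finite_feet_of_normal {K : Type*} [Field K] {f : MvPolynomial (Fin 2) K} {p : Fin 2 → K}
    (hp : normalVector f p ≠ 0) (h_line : ∃ t : K, eval (p + t • grad f p) f ≠ 0) :
    {q | IsNormalAt f q (Projectivization.mk K _ hp)}.Finite := by
  classical
  obtain ⟨t, ht⟩ := h_line
  have restrict_ne_zero : restrictLine p (grad f p) f ≠ 0 := by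
    intro h
    rw [← eval_restrictLine, h, Polynomial.eval_zero] at ht
    exact ht rfl
  refine ((restrictLine p (grad f p) f).roots.toFinset.finite_toSet.image
    fun s => p + s • grad f p).subset ?_
  rintro q ⟨hq_zero, hq, h_eq⟩
  obtain ⟨s, rfl⟩ := exists_eq_add_smul_grad_of_mk_normalVector_eq hp hq h_eq
  refine ⟨s, ?_, rfl⟩
  rwa [Finset.mem_coe, Multiset.mem_toFinset, Polynomial.mem_roots restrict_ne_zero,
    Polynomial.IsRoot, eval_restrictLine]

theorem hasNoIsolatedPoint_curveOfNormals {f : MvPolynomial (Fin 2) K}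
    (h_line : ∀ p, eval p f = 0 → grad f p ≠ 0 → ∃ t : K, eval (p + t • grad f p) f ≠ 0) :
    HasNoIsolatedPoint (curveOfNormals f) := by
  rintro n q hq _ ⟨p, hp_zero, hp, rfl⟩ hqp
  rw [Ne, eval_rep_mk_eq_zero_iff hq] at hqp
  have hU : {x | normalVector f x ≠ 0 ∧ eval (normalVector f x) q ≠ 0} ∈ 𝓝 p :=
    ((continuous_normalVector f).continuousAt.eventually_ne hp).and
      (((MvPolynomial.continuous_eval q).comp
        (continuous_normalVector f)).continuousAt.eventually_ne hqp)
  refine fun h_finite =>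
    infinite_zeros_of_mem_nhds hp_zero (normalVector_eq_zero_iff.not.1 hp) hU ?_
  refine (h_finite.biUnion fun ℓ hℓ => ?_ :
    (⋃ ℓ ∈ {ℓ ∈ curveOfNormals f | eval ℓ.rep q ≠ 0}, {x | IsNormalAt f x ℓ}).Finite).subset ?_
  · obtain ⟨⟨x, hx_zero, hx, rfl⟩, -⟩ := hℓ
    exact finite_feet_of_normal hx (h_line x hx_zero (normalVector_eq_zero_iff.not.1 hx))
  · rintro x ⟨⟨hx, hqx⟩, hx_zero⟩
    rw [Ne, ← eval_rep_mk_eq_zero_iff hq hx] at hqx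
    exact Set.mem_biUnion ⟨⟨x, hx_zero, hx, rfl⟩, hqx⟩ ⟨hx_zero, hx, rfl⟩

theorem hasNoIsolatedPoint_curveOfNormals_real (f : MvPolynomial (Fin 2) ℝ) :
    HasNoIsolatedPoint (curveOfNormals f) :=
  hasNoIsolatedPoint_curveOfNormals fun p _ h_grad => by
    by_contra! h_line
    have h_self := grad_dotProduct_eq_zero_of_forall_eval_eq_zero h_line 0
    rw [zero_smul, add_zero, dotProduct_self_eq_zero] at h_self
    exact h_grad h_self

theorem realDegree_curveOfNormals_le {f : MvPolynomial (Fin 2) ℝ} (hf : 1 ≤ f.totalDegree) :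
    realDegree (curveOfNormals f) ≤ (f.totalDegree : ℕ∞) ^ 2 := by
  have hf0 : f ≠ 0 := by
    rintro rfl
    simp at hf
  obtain ⟨n, hn⟩ := (hasNoIsolatedPoint_curveOfNormals_real f).exists_hasDegree
    (projIdeal_curveOfNormals_ne_bot hf0)
  have hn_le := hn.le_totalDegree_sq hf
  obtain ⟨h, -, h_homogeneous, hI⟩ := hn
  refine iSup₂_le fun w hw => ?_
  obtain ⟨u, huw, hu⟩ := hw.exists_eval_ne_zero hI
  refine (encard_projClosure_inter_pencil_le h_homogeneous hI huw hu).trans ?_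
  exact_mod_cast hn_le

end Analysis

/-! ### Infinitesimal rotations -/

section Derivation

variable {R A : Type*} [CommRing R] [CommRing A] [Algebra R A]

theorem squarefree_of_isRelPrime_derivation (D : Derivation R A A) {a : A}
    (h : IsRelPrime a (D a)) : Squarefree a := by
  rintro q ⟨r, rfl⟩
  refine h ((dvd_mul_right q q).mul_right r) ?_
  simp only [Derivation.leibniz, smul_eq_mul]
  exact dvd_add ((dvd_mul_right q q).mul_right _)
    (((dvd_mul_right q _).add (dvd_mul_right q _)).mul_left r)

variable [DecompositionMonoid A]

theorem isRelPrime_mul_derivation_mul {D : Derivation R A A} {a b : A} (hab : IsRelPrime a b)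
    (ha : IsRelPrime a (D a)) (hb : IsRelPrime b (D b)) : IsRelPrime (a * b) (D (a * b)) := by
  rw [Derivation.leibniz, smul_eq_mul, smul_eq_mul]
  refine .mul_left ?_ ?_
  · exact .mul_add_left_right (hab.mul_right ha) _
  · exact .add_mul_left_right (hab.symm.mul_right hb) _

theorem isRelPrime_prod_derivation_prod {ι : Type*} {D : Derivation R A A} {g : ι → A}
    (s : Finset ι) (h_pairwise : Pairwise fun i j => IsRelPrime (g i) (g j))
    (hg : ∀ i, IsRelPrime (g i) (D (g i))) : IsRelPrime (∏ i ∈ s, g i) (D (∏ i ∈ s, g i)) := by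
  classical
  induction s using Finset.induction_on with
  | empty =>
    rw [Finset.prod_empty]
    exact isRelPrime_one_left
  | insert i s hi ih =>
    rw [Finset.prod_insert hi]
    refine isRelPrime_mul_derivation_mul (.prod_right fun j hj => h_pairwise ?_) (hg i) ih
    rintro rfl
    exact hi hj

end Derivation

section Rotation

variable {K : Type*} [Field K]

/-- The derivative along the field `x ↦ (z 1 - x 1, x 0 - z 0)` of infinitesimal rotations about
`z`, up to sign. The feet of the normals of `f = 0` through `z` are zeros of `rotation z f`. -/
def rotation (z : Fin 2 → K) :
    Derivation K (MvPolynomial (Fin 2) K) (MvPolynomial (Fin 2) K) :=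
  (C (z 0) - X 0 : MvPolynomial (Fin 2) K) • pderiv 1 -
    (C (z 1) - X 1 : MvPolynomial (Fin 2) K) • pderiv 0

theorem rotation_apply (z : Fin 2 → K) (f : MvPolynomial (Fin 2) K) :
    rotation z f = (C (z 0) - X 0) * pderiv 1 f - (C (z 1) - X 1) * pderiv 0 f :=
  rfl

theorem eval_rotation (z p : Fin 2 → K) (f : MvPolynomial (Fin 2) K) :
    eval p (rotation z f) = wedge (z - p) (grad f p) := by
  simp [rotation_apply, wedge, grad]

theorem totalDegree_rotation_le (z : Fin 2 → K) (f : MvPolynomial (Fin 2) K) :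
    (rotation z f).totalDegree ≤ f.totalDegree := by
  rcases Nat.eq_zero_or_pos f.totalDegree with h | h
  · rw [totalDegree_eq_zero_iff_eq_C] at h
    rw [h]
    simp
  have h_linear (i : Fin 2) : (C (z i) - X i : MvPolynomial (Fin 2) K).totalDegree ≤ 1 :=
    (totalDegree_sub _ _).trans (by simp)
  have h_term (i j : Fin 2) : ((C (z i) - X i) * pderiv j f).totalDegree ≤ f.totalDegree := by
    have := totalDegree_mul (C (z i) - X i) (pderiv j f)
    have := h_linear i
    have := totalDegree_pderiv_le j f
    omega
  exact (totalDegree_sub _ _).trans (max_le (h_term 0 1) (h_term 1 0))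

theorem homogeneousComponent_rotation (z : Fin 2 → K) {f : MvPolynomial (Fin 2) K} {d : ℕ}
    (hf : f.totalDegree ≤ d) :
    homogeneousComponent d (rotation z f) = rotation 0 (homogeneousComponent d f) := by
  rcases Nat.eq_zero_or_pos d with rfl | hd
  · rw [totalDegree_eq_zero_iff_eq_C.1 (Nat.le_zero.1 hf)]
    simp
  obtain ⟨m, rfl⟩ := Nat.exists_eq_add_of_lt hd
  have h_linear (i : Fin 2) : (C (z i) - X i : MvPolynomial (Fin 2) K).totalDegree ≤ 1 :=
    (totalDegree_sub _ _).trans (by simp)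
  have h_leading (i : Fin 2) :
      homogeneousComponent 1 (C (z i) - X i : MvPolynomial (Fin 2) K) = -X i := by
    rw [map_sub, homogeneousComponent_of_mem (isHomogeneous_C _ _),
      homogeneousComponent_of_mem (isHomogeneous_X _ _)]
    simp
  have h_term (i j : Fin 2) : homogeneousComponent (m + 1) ((C (z i) - X i) * pderiv j f) =
      -X i * pderiv j (homogeneousComponent (m + 1) f) := by
    have h_pderiv : (pderiv j f).totalDegree ≤ m := by
      have := totalDegree_pderiv_le j f
      omega
    rw [add_comm m, homogeneousComponent_mul (h_linear i) h_pderiv, h_leading,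
      homogeneousComponent_pderiv, add_comm m]
  rw [zero_add, rotation_apply, map_sub, h_term, h_term, rotation_apply]
  simp

theorem isRelPrime_linForm {a b : Fin 2 → K} (h : wedge a b ≠ 0) :
    IsRelPrime (linForm a) (linForm b) := by
  intro q ha hb
  have h_unit : IsUnit (C (wedge a b) : MvPolynomial (Fin 2) K) := (IsUnit.mk0 _ h).map C
  have h₀ : q ∣ X 0 := by
    rw [← h_unit.dvd_mul_left]
    convert dvd_sub (ha.mul_left (C (b 1))) (hb.mul_left (C (a 1))) using 1
    simp only [linForm, Fin.sum_univ_two, wedge, map_sub, map_mul]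
    ring
  have h₁ : q ∣ X 1 := by
    rw [← h_unit.dvd_mul_left]
    convert dvd_sub (hb.mul_left (C (a 0))) (ha.mul_left (C (b 0))) using 1
    simp only [linForm, Fin.sum_univ_two, wedge, map_sub, map_mul]
    ring
  refine (X_prime.irreducible.isRelPrime_iff_not_dvd.2 fun h_dvd => ?_) h₀ h₁
  exact zero_ne_one (X_dvd_X.1 h_dvd)

theorem rotation_zero_linForm (a : Fin 2 → K) : rotation 0 (linForm a) = linForm ![-a 1, a 0] := by
  simp [rotation_apply, linForm, pderiv_X]
  ring

theorem wedge_eq_zero_of_dotProduct_eq_zero {v u : Fin 2 → K} (hv : v ≠ 0) (hvv : v ⬝ᵥ v = 0)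
    (huv : u ⬝ᵥ v = 0) : wedge v u = 0 := by
  obtain ⟨i, hi⟩ := Function.ne_iff.1 hv
  rw [dotProduct, Fin.sum_univ_two] at hvv huv
  refine (mul_eq_zero.1 (?_ : wedge v u * v i = 0)).resolve_right hi
  fin_cases i <;> simp only [Fin.zero_eta, Fin.mk_one, wedge]
  · linear_combination u 1 * hvv - v 1 * huv
  · linear_combination v 0 * huv - u 0 * hvv

/-- The curve `f = 0` is reduced, and none of its components is invariant under the infinitesimal
rotations about a point: it contains no circle and no isotropic line. -/
def HasNoCircularComponent (f : MvPolynomial (Fin 2) K) : Prop :=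
  ∀ z, IsRelPrime f (rotation z f)

namespace HasNoCircularComponent

variable {f : MvPolynomial (Fin 2) K}

theorem of_isRelPrime_homogeneousComponent {d : ℕ} (hf : f.totalDegree ≤ d)
    (h : IsRelPrime (homogeneousComponent d f) (rotation 0 (homogeneousComponent d f))) :
    HasNoCircularComponent f := fun z => by
  refine isRelPrime_of_isRelPrime_homogeneousComponent hf
    ((totalDegree_rotation_le z f).trans hf) ?_
  rwa [homogeneousComponent_rotation z hf]

theorem squarefree (h : HasNoCircularComponent f) : Squarefree f :=
  squarefree_of_isRelPrime_derivation (rotation 0) (h 0)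

theorem encard_zeros_le (h : HasNoCircularComponent f) (hf : 1 ≤ f.totalDegree)
    (z : Fin 2 → K) : {p | eval p f = 0 ∧ eval p (rotation z f) = 0}.encard ≤
      ((f.totalDegree ^ 2 : ℕ) : ℕ∞) := by
  have hf0 : f ≠ 0 := by
    rintro rfl
    simp at hf
  have h_rotation : rotation z f ≠ 0 := by
    intro h0
    have h_unit := h z
    rw [h0, isRelPrime_zero_right, isUnit_iff_totalDegree_of_isReduced] at h_unit
    omega
  refine (encard_commonZeros_le hf0 h_rotation (h z)).trans (Nat.cast_le.2 ?_)
  rw [sq]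
  exact Nat.mul_le_mul_left _ (totalDegree_rotation_le z f)

theorem exists_eval_add_smul_grad_ne_zero [Infinite K] (h : HasNoCircularComponent f)
    (hf : 1 ≤ f.totalDegree) {p : Fin 2 → K} (hp : grad f p ≠ 0) :
    ∃ t : K, eval (p + t • grad f p) f ≠ 0 := by
  by_contra! h_line
  have h_grad := grad_dotProduct_eq_zero_of_forall_eval_eq_zero h_line
  have h_isotropic := h_grad 0
  rw [zero_smul, add_zero] at h_isotropic
  have h_rotation (t : K) : eval (p + t • grad f p) (rotation p f) = 0 := by
    have h_wedge : wedge (grad f p) (grad f (p + t • grad f p)) = 0 :=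
      wedge_eq_zero_of_dotProduct_eq_zero hp h_isotropic (h_grad t)
    rw [eval_rotation]
    simp only [wedge, Pi.sub_apply, Pi.add_apply, Pi.smul_apply, smul_eq_mul] at h_wedge ⊢
    linear_combination -t * h_wedge
  have h_infinite : (Set.range fun t : K => p + t • grad f p).Infinite :=
    Set.infinite_range_of_injective
      ((add_right_injective p).comp (smul_left_injective K hp))
  refine h_infinite ((Set.finite_of_encard_le_coe (h.encard_zeros_le hf p)).subset ?_)
  rintro _ ⟨t, rfl⟩
  exact ⟨h_line t, h_rotation t⟩

theorem hasNoIsolatedPoint {K : Type*} [NontriviallyNormedField K] [CompleteSpace K]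
    {f : MvPolynomial (Fin 2) K} (h : HasNoCircularComponent f) (hf : 1 ≤ f.totalDegree) :
    HasNoIsolatedPoint (curveOfNormals f) :=
  hasNoIsolatedPoint_curveOfNormals fun _ _ hp => h.exists_eval_add_smul_grad_ne_zero hf hp

end HasNoCircularComponent

end Rotation

/-! ### Products of affine forms -/

section AffineForm

variable {K : Type*} [Field K]

/-- The conormal vector of the line `l 0 * X + l 1 * Y + l 2 = 0`. -/
def conormal (l : Fin 3 → K) : Fin 2 → K := ![l 0, l 1]

/-- The polynomial `l 0 * X + l 1 * Y + l 2`; see `linePoly_eq_affineForm`. -/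
def affineForm (l : Fin 3 → K) : MvPolynomial (Fin 2) K :=
  linForm (conormal l) + C (l 2)

theorem linePoly_eq_affineForm (l : Fin 3 → ℝ) : linePoly l = affineForm l := by
  simp [linePoly, affineForm, linForm, conormal]

theorem eval_affineForm (l : Fin 3 → K) (p : Fin 2 → K) :
    eval p (affineForm l) = p ⬝ᵥ conormal l + l 2 := by
  simp [affineForm]

theorem grad_affineForm (l : Fin 3 → K) (p : Fin 2 → K) : grad (affineForm l) p = conormal l := by
  ext i
  fin_cases i <;> simp [grad, affineForm, linForm, pderiv_X]

theorem totalDegree_affineForm_le (l : Fin 3 → K) : (affineForm l).totalDegree ≤ 1 :=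
  (totalDegree_add _ _).trans (max_le (isHomogeneous_linForm _).totalDegree_le (by simp))

theorem homogeneousComponent_affineForm (l : Fin 3 → K) :
    homogeneousComponent 1 (affineForm l) = linForm (conormal l) := by
  rw [affineForm, map_add, homogeneousComponent_of_mem (isHomogeneous_linForm _),
    homogeneousComponent_of_mem (isHomogeneous_C _ _)]
  simp

theorem totalDegree_prod_affineForm_le {ι : Type*} (s : Finset ι) (M : ι → Fin 3 → K) :
    (∏ i ∈ s, affineForm (M i)).totalDegree ≤ s.card :=
  (totalDegree_finsetProd _ _).trans
    ((Finset.sum_le_card_nsmul _ _ 1 fun _ _ => totalDegree_affineForm_le _).trans (by simp))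

variable {ι : Type*} [Fintype ι] {M : ι → Fin 3 → K} {R : MvPolynomial (Fin 2) K}

theorem homogeneousComponent_prod_affineForm_add (hR : R.totalDegree < Fintype.card ι) :
    homogeneousComponent (Fintype.card ι) (∏ i, affineForm (M i) + R) =
      ∏ i, linForm (conormal (M i)) := by
  have h_prod := homogeneousComponent_prod Finset.univ (fun i => affineForm (M i))
    fun i _ => totalDegree_affineForm_le (M i)
  rw [Finset.card_univ, mul_one] at h_prod
  rw [map_add, homogeneousComponent_eq_zero _ _ hR, add_zero, h_prod]
  exact Finset.prod_congr rfl fun i _ => homogeneousComponent_affineForm _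

theorem totalDegree_prod_affineForm_add_le (hR : R.totalDegree < Fintype.card ι) :
    (∏ i, affineForm (M i) + R).totalDegree ≤ Fintype.card ι :=
  (totalDegree_add _ _).trans (max_le (totalDegree_prod_affineForm_le _ M) hR.le)

theorem totalDegree_prod_affineForm_add (hM : ∀ i, conormal (M i) ≠ 0)
    (hR : R.totalDegree < Fintype.card ι) :
    (∏ i, affineForm (M i) + R).totalDegree = Fintype.card ι := by
  refine (totalDegree_prod_affineForm_add_le hR).antisymm (not_lt.1 fun h_lt => ?_)
  have h_zero := homogeneousComponent_eq_zero _ _ h_lt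
  rw [homogeneousComponent_prod_affineForm_add hR, Finset.prod_eq_zero_iff] at h_zero
  obtain ⟨i, -, hi⟩ := h_zero
  obtain ⟨u, hu⟩ := exists_dotProduct_ne_zero (hM i)
  rw [dotProduct_comm, ← eval_linForm, hi, map_zero] at hu
  exact hu rfl

theorem hasNoCircularComponent_prod_affineForm_add
    (h_parallel : Pairwise fun i j => wedge (conormal (M i)) (conormal (M j)) ≠ 0)
    (h_isotropic : ∀ i, conormal (M i) ⬝ᵥ conormal (M i) ≠ 0)
    (hR : R.totalDegree < Fintype.card ι) :
    HasNoCircularComponent (∏ i, affineForm (M i) + R) := by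
  refine .of_isRelPrime_homogeneousComponent (totalDegree_prod_affineForm_add_le hR) ?_
  rw [homogeneousComponent_prod_affineForm_add hR]
  refine isRelPrime_prod_derivation_prod _ (fun i j hij => isRelPrime_linForm (h_parallel hij))
    fun i => ?_
  rw [rotation_zero_linForm]
  refine isRelPrime_linForm ?_
  convert h_isotropic i using 1
  simp [wedge, dotProduct, Fin.sum_univ_two]

end AffineForm

/-! ### Full systems of feet -/

section Foot

variable {K : Type*} [Field K] {f : MvPolynomial (Fin 2) K} {z p q : Fin 2 → K}

/-- `p` is the foot of a normal to the curve `f = 0` that passes through `z`. -/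
structure IsFoot (f : MvPolynomial (Fin 2) K) (z p : Fin 2 → K) : Prop where
  eval_eq_zero : eval p f = 0
  grad_ne_zero : grad f p ≠ 0
  wedge_eq_zero : wedge (z - p) (grad f p) = 0

theorem mk_normalVector_mem_pencil_iff (hp : normalVector f p ≠ 0) :
    Projectivization.mk K _ hp ∈ pencil (toProj z) ↔ wedge (z - p) (grad f p) = 0 := by
  rw [← normalVector_dotProduct]
  exact Projectivization.orthogonal_mk _ _

namespace IsFoot

/-- The normal at the foot `p`, as a point of the dual plane. -/
def normal (h : IsFoot f z p) : DualPlane K :=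
  Projectivization.mk K (normalVector f p) (normalVector_eq_zero_iff.not.2 h.grad_ne_zero)

theorem isNormalAt (h : IsFoot f z p) : IsNormalAt f p h.normal :=
  ⟨h.eval_eq_zero, _, rfl⟩

theorem normal_mem_pencil (h : IsFoot f z p) : h.normal ∈ pencil (toProj z) :=
  (mk_normalVector_mem_pencil_iff _).2 h.wedge_eq_zero

theorem normal_ne_normal (hp : IsFoot f z p) (hq : IsFoot f z q)
    (h : wedge (p - z) (q - z) ≠ 0) : hp.normal ≠ hq.normal := by
  intro h_eq
  obtain ⟨s, rfl⟩ := exists_eq_add_smul_grad_of_mk_normalVector_eq _ _ h_eq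
  have h_wedge := hp.wedge_eq_zero
  simp only [wedge, Pi.sub_apply, Pi.add_apply, Pi.smul_apply, smul_eq_mul] at h h_wedge
  exact h (by linear_combination -s * h_wedge)

end IsFoot

end Foot

/-- `P` lists the feet of as many normals through `z` to the curve `f = 0` as Bézout's theorem
allows. The feet are seen from `z` in different directions, so that their normals are different. -/
structure IsFullFootSystem {K ι : Type*} [Field K] [Fintype ι] (f : MvPolynomial (Fin 2) K)
    (z : Fin 2 → K) (P : ι → Fin 2 → K) : Prop where
  hasNoCircularComponent : HasNoCircularComponent f
  one_le_totalDegree : 1 ≤ f.totalDegree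
  card_eq : Fintype.card ι = f.totalDegree ^ 2
  isFoot : ∀ a, IsFoot f z (P a)
  wedge_ne_zero : Pairwise fun a b => wedge (P a - z) (P b - z) ≠ 0

namespace IsFullFootSystem

section Field

variable {K ι : Type*} [Field K] [Fintype ι] {f : MvPolynomial (Fin 2) K}
  {z : Fin 2 → K} {P : ι → Fin 2 → K}

theorem injective (h : IsFullFootSystem f z P) : Function.Injective P := fun a b hab => by
  by_contra h_ne
  exact h.wedge_ne_zero h_ne (by rw [hab, wedge_self])

theorem range_eq (h : IsFullFootSystem f z P) :
    Set.range P = {p | eval p f = 0 ∧ eval p (rotation z f) = 0} := by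
  refine (Set.finite_range P).eq_of_subset_of_encard_le ?_ ?_
  · rintro _ ⟨a, rfl⟩
    exact ⟨(h.isFoot a).eval_eq_zero, by rw [eval_rotation, (h.isFoot a).wedge_eq_zero]⟩
  · rw [← Set.image_univ, h.injective.encard_image, Set.encard_univ, ENat.card_eq_coe_fintype_card,
      h.card_eq]
    exact h.hasNoCircularComponent.encard_zeros_le h.one_le_totalDegree z

theorem mem_range (h : IsFullFootSystem f z P) {p : Fin 2 → K} (h_eval : eval p f = 0)
    (h_wedge : wedge (z - p) (grad f p) = 0) : p ∈ Set.range P := by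
  rw [h.range_eq]
  exact ⟨h_eval, by rw [eval_rotation, h_wedge]⟩

theorem normalsThrough_eq (h : IsFullFootSystem f z P) :
    normalsThrough f z = Set.range fun a => (h.isFoot a).normal := by
  ext ℓ
  constructor
  · rintro ⟨⟨p, h_eval, hp, rfl⟩, hz⟩
    obtain ⟨a, rfl⟩ := h.mem_range h_eval ((mk_normalVector_mem_pencil_iff hp).1 hz)
    exact ⟨a, rfl⟩
  · rintro ⟨a, rfl⟩
    exact ⟨⟨P a, (h.isFoot a).isNormalAt⟩, (h.isFoot a).normal_mem_pencil⟩

theorem encard_normalsThrough (h : IsFullFootSystem f z P) :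
    (normalsThrough f z).encard = ((f.totalDegree ^ 2 : ℕ) : ℕ∞) := by
  have h_injective : Function.Injective fun a => (h.isFoot a).normal := fun a b hab => by
    by_contra h_ne
    exact (h.isFoot a).normal_ne_normal (h.isFoot b) (h.wedge_ne_zero h_ne) hab
  rw [h.normalsThrough_eq, ← Set.image_univ, h_injective.encard_image, Set.encard_univ,
    ENat.card_eq_coe_fintype_card, h.card_eq]

theorem isNonsingular (h : IsFullFootSystem f z P) : IsNonsingular f := by
  intro p hp
  by_contra! h_singular
  have h_grad : grad f p = 0 := funext h_singular
  obtain ⟨a, rfl⟩ := h.mem_range hp (by rw [h_grad]; simp [wedge])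
  exact (h.isFoot a).grad_ne_zero h_grad

end Field

section NontriviallyNormedField

variable {K ι : Type*} [NontriviallyNormedField K] [CompleteSpace K] [Fintype ι]
  {f : MvPolynomial (Fin 2) K} {z : Fin 2 → K} {P : ι → Fin 2 → K}

theorem exists_projIdeal_eq_span (h : IsFullFootSystem f z P) :
    ∃ e : MvPolynomial (Fin 3) K, e ≠ 0 ∧ e.IsHomogeneous (f.totalDegree ^ 2) ∧
      projIdeal (curveOfNormals f) = Ideal.span {e} ∧
      ∃ u : Fin 3 → K, u ⬝ᵥ (toProj z).rep = 0 ∧ eval u e ≠ 0 := by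
  have hf0 : f ≠ 0 := by
    rintro rfl
    simpa using h.one_le_totalDegree
  have h_no_isolated := h.hasNoCircularComponent.hasNoIsolatedPoint h.one_le_totalDegree
  obtain ⟨n, h_degree⟩ := h_no_isolated.exists_hasDegree (projIdeal_curveOfNormals_ne_bot hf0)
  have h_le := h_degree.le_totalDegree_sq h.one_le_totalDegree
  obtain ⟨e, he0, he, hI⟩ := h_degree
  obtain ⟨u, huz, hu⟩ := h_no_isolated.exists_eval_ne_zero he0 he hI
    (Set.finite_of_encard_eq_coe h.encard_normalsThrough)
  have h_card : ((f.totalDegree ^ 2 : ℕ) : ℕ∞) ≤ n := by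
    rw [← h.encard_normalsThrough]
    exact (Set.encard_le_encard (Set.inter_subset_inter_left _ (subset_projClosure _))).trans
      (encard_projClosure_inter_pencil_le he hI huz hu)
  obtain rfl := h_le.antisymm (Nat.cast_le.1 h_card)
  exact ⟨e, he0, he, hI, u, huz, hu⟩

theorem hasDegree (h : IsFullFootSystem f z P) :
    HasDegree (curveOfNormals f) (f.totalDegree ^ 2) := by
  obtain ⟨e, he0, he, hI, -⟩ := h.exists_projIdeal_eq_span
  exact ⟨e, he0, he, hI⟩

theorem encard_projClosure_inter_pencil (h : IsFullFootSystem f z P) :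
    (projClosure (curveOfNormals f) ∩ pencil (toProj z)).encard =
      ((f.totalDegree ^ 2 : ℕ) : ℕ∞) := by
  obtain ⟨e, -, he, hI, u, huz, hu⟩ := h.exists_projIdeal_eq_span
  refine (encard_projClosure_inter_pencil_le he hI huz hu).antisymm ?_
  rw [← h.encard_normalsThrough]
  exact Set.encard_le_encard (Set.inter_subset_inter_left _ (subset_projClosure _))

theorem meetsTransversally (h : IsFullFootSystem f z P) :
    MeetsTransversally (toProj z) (curveOfNormals f) := by
  obtain ⟨e, -, he, hI, u, huz, hu⟩ := h.exists_projIdeal_eq_span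
  exact meetsTransversally_of_encard_eq he hI huz hu h.encard_projClosure_inter_pencil

end NontriviallyNormedField

end IsFullFootSystem

section Complexify

theorem eval_complexify (f : MvPolynomial (Fin 2) ℝ) (p : Fin 2 → ℝ) :
    eval (toComplex p) (complexify f) = ((eval p f : ℝ) : ℂ) := by
  rw [complexify, eval_map]
  exact (eval₂_comp_left (algebraMap ℝ ℂ) (RingHom.id ℝ) p f).symm

theorem grad_complexify (f : MvPolynomial (Fin 2) ℝ) (p : Fin 2 → ℝ) :
    grad (complexify f) (toComplex p) = toComplex (grad f p) := by
  ext i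
  rw [grad, complexify, pderiv_map]
  exact eval_complexify _ p

theorem wedge_toComplex (u v : Fin 2 → ℝ) :
    wedge (toComplex u) (toComplex v) = ((wedge u v : ℝ) : ℂ) := by
  simp [wedge, toComplex]

theorem dotProduct_toComplex (u v : Fin 2 → ℝ) :
    toComplex u ⬝ᵥ toComplex v = ((u ⬝ᵥ v : ℝ) : ℂ) := by
  simp [dotProduct, toComplex]

theorem conormal_ofReal (l : Fin 3 → ℝ) :
    conormal (fun i => (l i : ℂ)) = toComplex (conormal l) := by
  ext i
  fin_cases i <;> rfl

theorem toComplex_sub (u v : Fin 2 → ℝ) : toComplex (u - v) = toComplex u - toComplex v := by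
  ext i
  simp [toComplex]

theorem toComplex_ne_zero {u : Fin 2 → ℝ} (hu : u ≠ 0) : toComplex u ≠ 0 := by
  obtain ⟨i, hi⟩ := Function.ne_iff.1 hu
  exact Function.ne_iff.2 ⟨i, Complex.ofReal_ne_zero.2 hi⟩

theorem totalDegree_complexify (f : MvPolynomial (Fin 2) ℝ) :
    (complexify f).totalDegree = f.totalDegree := by
  rw [totalDegree, totalDegree, complexify,
    support_map_of_injective f (algebraMap ℝ ℂ).injective]

theorem complexify_affineForm (l : Fin 3 → ℝ) :
    complexify (affineForm l) = affineForm fun i => (l i : ℂ) := by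
  simp [complexify, affineForm, linForm, conormal]

theorem complexify_prod_affineForm_add {ι : Type*} [Fintype ι] (M : ι → Fin 3 → ℝ)
    (R : MvPolynomial (Fin 2) ℝ) : complexify (∏ i, affineForm (M i) + R) =
      ∏ i, affineForm (fun j => (M i j : ℂ)) + complexify R := by
  rw [complexify, map_add, map_prod]
  exact congrArg (· + _) (Finset.prod_congr rfl fun i _ => complexify_affineForm (M i))

variable {f : MvPolynomial (Fin 2) ℝ} {z : Fin 2 → ℝ}

protected theorem IsFoot.toComplex {p : Fin 2 → ℝ} (h : IsFoot f z p) :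
    IsFoot (complexify f) (toComplex z) (toComplex p) where
  eval_eq_zero := by rw [eval_complexify, h.eval_eq_zero, Complex.ofReal_zero]
  grad_ne_zero := by
    rw [grad_complexify]
    exact toComplex_ne_zero h.grad_ne_zero
  wedge_eq_zero := by
    rw [grad_complexify, ← toComplex_sub, wedge_toComplex, h.wedge_eq_zero, Complex.ofReal_zero]

variable {ι : Type*} [Fintype ι] {P : ι → Fin 2 → ℝ}

protected theorem IsFullFootSystem.complexify (h : IsFullFootSystem f z P)
    (h_complex : HasNoCircularComponent (complexify f)) :
    IsFullFootSystem (complexify f) (toComplex z) fun a => toComplex (P a) where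
  hasNoCircularComponent := h_complex
  one_le_totalDegree := (totalDegree_complexify f).symm ▸ h.one_le_totalDegree
  card_eq := (totalDegree_complexify f).symm ▸ h.card_eq
  isFoot a := (h.isFoot a).toComplex
  wedge_ne_zero a b hab := by
    simp only [← toComplex_sub, wedge_toComplex]
    exact Complex.ofReal_ne_zero.2 (h.wedge_ne_zero hab)

theorem IsFullFootSystem.allNormalsReal (h : IsFullFootSystem f z P)
    (h_complex : HasNoCircularComponent (complexify f)) : AllNormalsReal f z := by
  rintro p _ ⟨h_eval, hp, rfl⟩ hz
  obtain ⟨a, rfl⟩ :=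
    (h.complexify h_complex).mem_range h_eval ((mk_normalVector_mem_pencil_iff hp).1 hz)
  exact ⟨P a, rfl⟩

theorem IsFullFootSystem.realDegree_eq (h : IsFullFootSystem f z P) :
    realDegree (curveOfNormals f) = (f.totalDegree : ℕ∞) ^ 2 := by
  refine (realDegree_curveOfNormals_le h.one_le_totalDegree).antisymm ?_
  rw [← Nat.cast_pow, ← h.encard_projClosure_inter_pencil]
  exact le_iSup₂_of_le (toProj z) h.meetsTransversally le_rfl

end Complexify

/-! ### Deformation of nondegenerate solutions -/

section Deformation

theorem contDiff_eval (f : MvPolynomial (Fin 2) ℝ) : ContDiff ℝ 1 fun x : Fin 2 → ℝ => eval x f :=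
  (AnalyticOnNhd.eval_mvPolynomial f).contDiff

theorem eq_zero_of_dotProduct_eq_zero {K : Type*} [Field K] {a b v : Fin 2 → K}
    (h : wedge a b ≠ 0) (ha : a ⬝ᵥ v = 0) (hb : b ⬝ᵥ v = 0) : v = 0 := by
  rw [dotProduct, Fin.sum_univ_two] at ha hb
  ext i
  refine (mul_eq_zero.1 (?_ : wedge a b * v i = 0)).resolve_left h
  fin_cases i <;> simp only [Fin.zero_eta, Fin.mk_one, wedge]
  · linear_combination b 1 * ha - a 1 * hb
  · linear_combination a 0 * hb - b 0 * ha

theorem isInvertible_of_wedge_ne_zero {a b : Fin 2 → ℝ} (h : wedge a b ≠ 0) :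
    ((dotProductCLM a).prod (dotProductCLM b)).IsInvertible := by
  have h_ker : (((dotProductCLM a).prod (dotProductCLM b) : (Fin 2 → ℝ) →L[ℝ] ℝ × ℝ) :
      (Fin 2 → ℝ) →ₗ[ℝ] ℝ × ℝ).ker = ⊥ := by
    rw [LinearMap.ker_eq_bot']
    intro v hv
    obtain ⟨ha, hb⟩ := Prod.ext_iff.1 hv
    exact eq_zero_of_dotProduct_eq_zero h ha hb
  have h_range := LinearMap.range_eq_top.2
    ((LinearMap.injective_iff_surjective_of_finrank_eq_finrank (by simp)).1
      (LinearMap.ker_eq_bot.1 h_ker))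
  exact ⟨.ofBijective _ h_ker h_range, rfl⟩

theorem exists_tendsto_commonZero {A B : ℝ × (Fin 2 → ℝ) → ℝ} (hA : ContDiff ℝ 1 A)
    (hB : ContDiff ℝ 1 B) {f g : MvPolynomial (Fin 2) ℝ} (hAf : ∀ y, A (0, y) = eval y f)
    (hBg : ∀ y, B (0, y) = eval y g) {y₀ : Fin 2 → ℝ} (hf : eval y₀ f = 0) (hg : eval y₀ g = 0)
    (h_jacobian : wedge (grad f y₀) (grad g y₀) ≠ 0) :
    ∃ q : ℝ → Fin 2 → ℝ, Tendsto q (𝓝 0) (𝓝 y₀) ∧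
      ∀ᶠ δ in 𝓝 0, A (δ, q δ) = 0 ∧ B (δ, q δ) = 0 := by
  have hF : ContDiffAt ℝ 1 (fun x => (A x, B x)) (0, y₀) := (hA.prodMk hB).contDiffAt
  have h_restrict : HasFDerivAt (fun y => (A (0, y), B (0, y)))
      ((dotProductCLM (grad f y₀)).prod (dotProductCLM (grad g y₀))) y₀ := by
    simp only [hAf, hBg]
    exact (hasStrictFDerivAt_eval f y₀).hasFDerivAt.prodMk
      (hasStrictFDerivAt_eval g y₀).hasFDerivAt
  have h_partial := (((hF.differentiableAt one_ne_zero).hasFDerivAt.comp y₀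
    (hasFDerivAt_prodMk_right (𝕜 := ℝ) (0 : ℝ) y₀)).unique h_restrict)
  have h_invertible := h_partial ▸ isInvertible_of_wedge_ne_zero h_jacobian
  refine ⟨hF.implicitFunction one_ne_zero h_invertible,
    (hF.hasStrictFDerivAt one_ne_zero).tendsto_implicitFunctionOfProdDomain h_invertible, ?_⟩
  filter_upwards [hF.eventually_apply_implicitFunction one_ne_zero h_invertible] with δ hδ
  rw [hAf, hBg, hf, hg] at hδ
  exact Prod.ext_iff.1 hδ

end Deformation

/-! ### Feet near the arrangement -/

section Grad

variable {K : Type*} [Field K]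

theorem wedge_smul_right (c : K) (u v : Fin 2 → K) : wedge u (c • v) = c * wedge u v := by
  simp only [wedge, Pi.smul_apply, smul_eq_mul]
  ring

theorem grad_add {σ : Type*} (f g : MvPolynomial σ K) (p : σ → K) :
    grad (f + g) p = grad f p + grad g p := by
  ext i
  simp [grad]

theorem grad_mul {σ : Type*} (f g : MvPolynomial σ K) (p : σ → K) :
    grad (f * g) p = eval p f • grad g p + eval p g • grad f p := by
  ext i
  simp [grad]

theorem grad_C {σ : Type*} (c : K) (p : σ → K) : grad (C c : MvPolynomial σ K) p = 0 := by
  ext i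
  simp [grad]

theorem grad_linForm (a p : Fin 2 → K) : grad (linForm a) p = a := by
  ext i
  fin_cases i <;> simp [grad, linForm, pderiv_X]

theorem continuous_grad {σ : Type*} (f : MvPolynomial σ ℝ) : Continuous (grad f) :=
  continuous_pi fun _ => continuous_eval _

end Grad

section LocalFeet

variable {a b : Fin 3 → ℝ} {z v w : Fin 2 → ℝ} {G H P : MvPolynomial (Fin 2) ℝ}

theorem IsFoot.exists_tendsto (h : IsFoot G z w)
    (h_jacobian : wedge (grad G w) (grad (rotation z G) w) ≠ 0) (H : MvPolynomial (Fin 2) ℝ) :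
    ∃ p : ℝ → Fin 2 → ℝ, Tendsto p (𝓝[>] 0) (𝓝 w) ∧
      ∀ᶠ ε in 𝓝[>] 0, IsFoot (G + C ε * H) z (p ε) := by
  have h_smooth (f g : MvPolynomial (Fin 2) ℝ) :
      ContDiff ℝ 1 fun x : ℝ × (Fin 2 → ℝ) => eval x.2 f + x.1 * eval x.2 g :=
    ((contDiff_eval f).comp contDiff_snd).add
      (contDiff_fst.mul ((contDiff_eval g).comp contDiff_snd))
  obtain ⟨p, hp, h_zero⟩ := exists_tendsto_commonZero (h_smooth G H)
    (h_smooth (rotation z G) (rotation z H)) (fun y => by simp) (fun y => by simp)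
    h.eval_eq_zero (by rw [eval_rotation, h.wedge_eq_zero]) h_jacobian
  have h_grad : Tendsto (fun ε => grad G (p ε) + ε • grad H (p ε)) (𝓝 0) (𝓝 (grad G w)) := by
    simpa using ((continuous_grad G).tendsto w |>.comp hp).add
      (tendsto_id.smul ((continuous_grad H).tendsto w |>.comp hp))
  refine ⟨p, hp.mono_left nhdsWithin_le_nhds, Eventually.filter_mono nhdsWithin_le_nhds ?_⟩
  filter_upwards [h_zero, h_grad.eventually_ne h.grad_ne_zero] with ε hε h_ne
  have h_grad_eq : grad (G + C ε * H) (p ε) = grad G (p ε) + ε • grad H (p ε) := by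
    simp [grad_add, grad_mul, grad_C]
  refine ⟨by simpa using hε.1, by rwa [h_grad_eq], ?_⟩
  rw [← eval_rotation, ← hε.2]
  simp [Derivation.leibniz]

theorem isFoot_affineForm_mul (hw : eval w (affineForm a) = 0) (ha : conormal a ≠ 0)
    (h_perp : wedge (z - w) (conormal a) = 0) (hP : eval w P ≠ 0) :
    IsFoot (affineForm a * P) z w := by
  have h_grad : grad (affineForm a * P) w = eval w P • conormal a := by
    rw [grad_mul, hw, zero_smul, zero_add, grad_affineForm]
  refine ⟨by rw [map_mul, hw, zero_mul], by rw [h_grad]; exact smul_ne_zero hP ha, ?_⟩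
  rw [h_grad, wedge_smul_right, h_perp, mul_zero]

theorem rotation_affineForm (l : Fin 3 → ℝ) (z : Fin 2 → ℝ) :
    rotation z (affineForm l) = linForm ![-l 1, l 0] + C (wedge z (conormal l)) := by
  simp [rotation_apply, affineForm, linForm, conormal, wedge, pderiv_X]
  ring

theorem wedge_grad_affineForm_mul (hw : eval w (affineForm a) = 0)
    (h_perp : wedge (z - w) (conormal a) = 0) (P : MvPolynomial (Fin 2) ℝ) :
    wedge (grad (affineForm a * P) w) (grad (rotation z (affineForm a * P)) w) =
      eval w P ^ 2 * (conormal a ⬝ᵥ conormal a) := by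
  have h_rotation : eval w (rotation z (affineForm a)) = 0 := by
    rw [eval_rotation, grad_affineForm, h_perp]
  simp only [Derivation.leibniz, smul_eq_mul, grad_add, grad_mul, hw, h_rotation, grad_affineForm]
  rw [rotation_affineForm, grad_add, grad_linForm, grad_C]
  simp [wedge, dotProduct, Fin.sum_univ_two, conormal]
  ring

theorem exists_tendsto_isFoot_of_perpendicular (ha : conormal a ≠ 0)
    (hw : eval w (affineForm a) = 0) (h_perp : wedge (z - w) (conormal a) = 0)
    (hP : eval w P ≠ 0) (H : MvPolynomial (Fin 2) ℝ) :
    ∃ p : ℝ → Fin 2 → ℝ, Tendsto p (𝓝[>] 0) (𝓝 w) ∧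
      ∀ᶠ ε in 𝓝[>] 0, IsFoot (affineForm a * P + C ε * H) z (p ε) := by
  refine (isFoot_affineForm_mul hw ha h_perp hP).exists_tendsto ?_ H
  rw [wedge_grad_affineForm_mul hw h_perp]
  exact mul_ne_zero (pow_ne_zero 2 hP) (dotProduct_self_eq_zero.not.2 ha)

/-- The solution `y` of `y ⬝ᵥ a = wedge u a` and `y ⬝ᵥ b = -wedge u b`. The feet of the two normals
through `v + u` that lie near the node `v` of two lines with conormals `a` and `b` leave the node
in the directions `± nodeDirection a b u`. -/
def nodeDirection {K : Type*} [Field K] (a b u : Fin 2 → K) : Fin 2 → K :=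
  (wedge a b)⁻¹ • ![wedge u a * b 1 + wedge u b * a 1, -(wedge u a * b 0 + wedge u b * a 0)]

section NodeDirection

variable {K : Type*} [Field K] {a b u : Fin 2 → K}

theorem nodeDirection_swap (a b u : Fin 2 → K) : nodeDirection b a u = -nodeDirection a b u := by
  rw [nodeDirection, nodeDirection, wedge_swap, inv_neg, neg_smul, add_comm, add_comm (_ * b 0)]

theorem nodeDirection_dotProduct_left (h : wedge a b ≠ 0) :
    nodeDirection a b u ⬝ᵥ a = wedge u a := by
  rw [nodeDirection, smul_dotProduct, smul_eq_mul, inv_mul_eq_iff_eq_mul₀ h]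
  simp only [dotProduct, Fin.sum_univ_two, wedge, Matrix.cons_val_zero, Matrix.cons_val_one]
  ring

theorem nodeDirection_dotProduct_right (h : wedge a b ≠ 0) :
    nodeDirection a b u ⬝ᵥ b = -wedge u b := by
  rw [nodeDirection, smul_dotProduct, smul_eq_mul, inv_mul_eq_iff_eq_mul₀ h]
  simp only [dotProduct, Fin.sum_univ_two, wedge, Matrix.cons_val_zero, Matrix.cons_val_one]
  ring

theorem wedge_nodeDirection (a b u : Fin 2 → K) : wedge (nodeDirection a b u) u =
    (wedge a b)⁻¹ * (wedge u a * (u ⬝ᵥ b) + wedge u b * (u ⬝ᵥ a)) := by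
  simp [nodeDirection, wedge]
  ring

end NodeDirection

theorem eval_add_smul_affineForm {l : Fin 3 → ℝ} (hv : eval v (affineForm l) = 0) (δ : ℝ)
    (y : Fin 2 → ℝ) : eval (v + δ • y) (affineForm l) = δ * (y ⬝ᵥ conormal l) := by
  rw [eval_affineForm] at hv ⊢
  rw [add_dotProduct, smul_dotProduct, smul_eq_mul]
  linear_combination hv

/-- The gradient of `affineForm a * (affineForm b * P) + C (δ ^ 2) * H` at the point `v + δ • y`,
divided by `δ`, where `v` is the common point of the lines `a` and `b`. -/
def blowUpGrad (a b : Fin 3 → ℝ) (P H : MvPolynomial (Fin 2) ℝ) (v : Fin 2 → ℝ) (δ : ℝ)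
    (y : Fin 2 → ℝ) : Fin 2 → ℝ :=
  eval (v + δ • y) P • ((y ⬝ᵥ conormal b) • conormal a + (y ⬝ᵥ conormal a) • conormal b) +
    δ • (((y ⬝ᵥ conormal a) * (y ⬝ᵥ conormal b)) • grad P (v + δ • y) + grad H (v + δ • y))

theorem grad_add_smul (hva : eval v (affineForm a) = 0) (hvb : eval v (affineForm b) = 0)
    (P H : MvPolynomial (Fin 2) ℝ) (δ : ℝ) (y : Fin 2 → ℝ) :
    grad (affineForm a * (affineForm b * P) + C (δ ^ 2) * H) (v + δ • y) =
      δ • blowUpGrad a b P H v δ y := by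
  simp only [grad_add, grad_mul, grad_C, grad_affineForm, map_mul, eval_C,
    eval_add_smul_affineForm hva, eval_add_smul_affineForm hvb, blowUpGrad]
  module

theorem isFoot_add_smul (hva : eval v (affineForm a) = 0) (hvb : eval v (affineForm b) = 0)
    {δ : ℝ} (hδ : δ ≠ 0) {y : Fin 2 → ℝ}
    (h_eval : (y ⬝ᵥ conormal a) * (y ⬝ᵥ conormal b) * eval (v + δ • y) P + eval (v + δ • y) H = 0)
    (h_grad : blowUpGrad a b P H v δ y ≠ 0)
    (h_wedge : wedge (z - (v + δ • y)) (blowUpGrad a b P H v δ y) = 0) :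
    IsFoot (affineForm a * (affineForm b * P) + C (δ ^ 2) * H) z (v + δ • y) where
  eval_eq_zero := by
    simp only [map_add, map_mul, eval_C, eval_add_smul_affineForm hva, eval_add_smul_affineForm hvb]
    linear_combination δ ^ 2 * h_eval
  grad_ne_zero := by
    rw [grad_add_smul hva hvb]
    exact smul_ne_zero hδ h_grad
  wedge_eq_zero := by rw [grad_add_smul hva hvb, wedge_smul_right, h_wedge, mul_zero]

theorem contDiff_eval_add_smul (v : Fin 2 → ℝ) (f : MvPolynomial (Fin 2) ℝ) :
    ContDiff ℝ 1 fun x : ℝ × (Fin 2 → ℝ) => eval (v + x.1 • x.2) f :=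
  (contDiff_eval f).comp (by fun_prop)

theorem contDiff_dotProduct_snd (c : Fin 2 → ℝ) :
    ContDiff ℝ 1 fun x : ℝ × (Fin 2 → ℝ) => x.2 ⬝ᵥ c := by
  simp only [dotProduct, Fin.sum_univ_two]
  fun_prop

theorem contDiff_blowUpGrad (a b : Fin 3 → ℝ) (P H : MvPolynomial (Fin 2) ℝ) (v : Fin 2 → ℝ) :
    ContDiff ℝ 1 fun x : ℝ × (Fin 2 → ℝ) => blowUpGrad a b P H v x.1 x.2 := by
  have h_eval := contDiff_eval_add_smul v
  have h_grad (f : MvPolynomial (Fin 2) ℝ) :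
      ContDiff ℝ 1 fun x : ℝ × (Fin 2 → ℝ) => grad f (v + x.1 • x.2) :=
    contDiff_pi.2 fun i => h_eval (pderiv i f)
  have h_dot := contDiff_dotProduct_snd
  exact ((h_eval P).smul (((h_dot _).smul contDiff_const).add ((h_dot _).smul contDiff_const))).add
    (contDiff_fst.smul ((((h_dot _).mul (h_dot _)).smul (h_grad P)).add (h_grad H)))

theorem blowUpGrad_zero (a b : Fin 3 → ℝ) (P H : MvPolynomial (Fin 2) ℝ) (v y : Fin 2 → ℝ) :
    blowUpGrad a b P H v 0 y =
      eval v P • ((y ⬝ᵥ conormal b) • conormal a + (y ⬝ᵥ conormal a) • conormal b) := by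
  rw [blowUpGrad, zero_smul, zero_smul, add_zero, add_zero]

theorem wedge_grad_linForm_mul {K : Type*} [Field K] (a b y : Fin 2 → K) (c h s t : K) :
    wedge (grad (C c * (linForm a * linForm b) + C h) y)
        (grad (C c * (C s * linForm b + C t * linForm a)) y) =
      c ^ 2 * (s * (y ⬝ᵥ b) - t * (y ⬝ᵥ a)) * wedge a b := by
  simp only [grad_add, grad_mul, grad_C, grad_linForm, eval_C, eval_linForm, wedge, Pi.add_apply,
    Pi.smul_apply, Pi.zero_apply, smul_eq_mul]
  ring

theorem exists_tendsto_blowUp (h_parallel : wedge (conormal a) (conormal b) ≠ 0)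
    (ha : wedge (z - v) (conormal a) ≠ 0) (hb : wedge (z - v) (conormal b) ≠ 0)
    (hP : eval v P ≠ 0)
    (hH : eval v H = wedge (z - v) (conormal a) * wedge (z - v) (conormal b) * eval v P) :
    ∃ q : ℝ → Fin 2 → ℝ,
      Tendsto q (𝓝 0) (𝓝 (nodeDirection (conormal a) (conormal b) (z - v))) ∧
      ∀ᶠ δ in 𝓝 0, (q δ ⬝ᵥ conormal a) * (q δ ⬝ᵥ conormal b) * eval (v + δ • q δ) P +
          eval (v + δ • q δ) H = 0 ∧
        wedge (z - (v + δ • q δ)) (blowUpGrad a b P H v δ (q δ)) = 0 := by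
  have h_left := nodeDirection_dotProduct_left (u := z - v) h_parallel
  have h_right := nodeDirection_dotProduct_right (u := z - v) h_parallel
  refine exists_tendsto_commonZero
    (A := fun x => (x.2 ⬝ᵥ conormal a) * (x.2 ⬝ᵥ conormal b) * eval (v + x.1 • x.2) P +
      eval (v + x.1 • x.2) H)
    (B := fun x => wedge (z - (v + x.1 • x.2)) (blowUpGrad a b P H v x.1 x.2))
    (f := C (eval v P) * (linForm (conormal a) * linForm (conormal b)) + C (eval v H))
    (g := C (eval v P) * (C (wedge (z - v) (conormal a)) * linForm (conormal b) +
      C (wedge (z - v) (conormal b)) * linForm (conormal a)))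
    ((((contDiff_dotProduct_snd _).mul (contDiff_dotProduct_snd _)).mul
      (contDiff_eval_add_smul v P)).add (contDiff_eval_add_smul v H))
    ?_ (fun y => ?_) (fun y => ?_) ?_ ?_ ?_
  · have h_fst := contDiff_pi.1 (contDiff_blowUpGrad a b P H v) 0
    have h_snd := contDiff_pi.1 (contDiff_blowUpGrad a b P H v) 1
    simp only [wedge, Pi.sub_apply, Pi.add_apply, Pi.smul_apply, smul_eq_mul]
    fun_prop
  · simp only [zero_smul, add_zero, map_add, map_mul, eval_C, eval_linForm]
    ring
  · simp only [zero_smul, add_zero, map_add, map_mul, eval_C, eval_linForm, blowUpGrad_zero, wedge,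
      Pi.add_apply, Pi.smul_apply, smul_eq_mul]
    ring
  · simp only [map_add, map_mul, eval_C, eval_linForm, h_left, h_right, hH]
    ring
  · simp only [map_add, map_mul, eval_C, eval_linForm, h_left, h_right]
    ring
  · rw [wedge_grad_linForm_mul, h_left, h_right]
    refine mul_ne_zero (mul_ne_zero (pow_ne_zero 2 hP) ?_) h_parallel
    convert mul_ne_zero (neg_ne_zero.2 two_ne_zero) (mul_ne_zero ha hb) using 1
    ring

theorem blowUpGrad_zero_nodeDirection_ne_zero (h_parallel : wedge (conormal a) (conormal b) ≠ 0)
    (ha : wedge (z - v) (conormal a) ≠ 0) (hP : eval v P ≠ 0) :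
    blowUpGrad a b P H v 0 (nodeDirection (conormal a) (conormal b) (z - v)) ≠ 0 := by
  rw [blowUpGrad_zero, nodeDirection_dotProduct_left h_parallel]
  intro h
  have h_wedge := congrArg (wedge (conormal a)) h
  rw [wedge_smul_right] at h_wedge
  refine mul_ne_zero hP (mul_ne_zero ha h_parallel) ?_
  simp only [wedge, Pi.add_apply, Pi.smul_apply, Pi.zero_apply, smul_eq_mul] at h_wedge ⊢
  linear_combination h_wedge

theorem tendsto_sqrt_nhdsGT_zero : Tendsto Real.sqrt (𝓝[>] 0) (𝓝 0) := by
  simpa using (Real.continuous_sqrt.tendsto 0).mono_left nhdsWithin_le_nhds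

theorem exists_tendsto_isFoot_of_node (h_parallel : wedge (conormal a) (conormal b) ≠ 0)
    (hva : eval v (affineForm a) = 0) (hvb : eval v (affineForm b) = 0)
    (ha : wedge (z - v) (conormal a) ≠ 0) (hb : wedge (z - v) (conormal b) ≠ 0)
    (hP : eval v P ≠ 0)
    (hH : eval v H = wedge (z - v) (conormal a) * wedge (z - v) (conormal b) * eval v P) :
    ∃ r : ℝ → Fin 2 → ℝ,
      Tendsto r (𝓝[>] 0) (𝓝 (nodeDirection (conormal a) (conormal b) (z - v))) ∧
      ∀ᶠ ε in 𝓝[>] 0,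
        IsFoot (affineForm a * (affineForm b * P) + C ε * H) z (v + √ε • r ε) := by
  obtain ⟨q, hq, h_zero⟩ := exists_tendsto_blowUp h_parallel ha hb hP hH
  have h_sqrt := tendsto_sqrt_nhdsGT_zero
  have h_grad : ∀ᶠ δ in 𝓝 0, blowUpGrad a b P H v δ (q δ) ≠ 0 := by
    refine (((contDiff_blowUpGrad a b P H v).continuous.tendsto _).comp
      (tendsto_id.prodMk_nhds hq)).eventually_ne ?_
    exact blowUpGrad_zero_nodeDirection_ne_zero h_parallel ha hP
  refine ⟨q ∘ Real.sqrt, hq.comp h_sqrt, ?_⟩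
  filter_upwards [h_sqrt.eventually h_zero, h_sqrt.eventually h_grad, self_mem_nhdsWithin]
    with ε h_zero h_grad hε
  have h_foot := isFoot_add_smul hva hvb (Real.sqrt_ne_zero'.2 hε) h_zero.1 h_grad h_zero.2
  rwa [Real.sq_sqrt (le_of_lt hε)] at h_foot

theorem eventually_wedge_ne_zero {F : Filter ℝ} {p q : ℝ → Fin 2 → ℝ} {x y : Fin 2 → ℝ}
    (hp : Tendsto p F (𝓝 x)) (hq : Tendsto q F (𝓝 y)) (h : wedge x y ≠ 0) :
    ∀ᶠ ε in F, wedge (p ε) (q ε) ≠ 0 := by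
  have h_continuous : Continuous fun r : (Fin 2 → ℝ) × (Fin 2 → ℝ) => wedge r.1 r.2 := by
    unfold wedge
    fun_prop
  exact ((h_continuous.tendsto (x, y)).comp (hp.prodMk_nhds hq)).eventually_ne h

theorem eventually_wedge_add_smul_ne_zero {r s : ℝ → Fin 2 → ℝ} {y : Fin 2 → ℝ}
    (hr : Tendsto r (𝓝[>] 0) (𝓝 y)) (hs : Tendsto s (𝓝[>] 0) (𝓝 (-y)))
    (h : wedge y (z - v) ≠ 0) :
    ∀ᶠ ε in 𝓝[>] 0, wedge (v + √ε • r ε - z) (v + √ε • s ε - z) ≠ 0 := by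
  have h_sub : Tendsto (fun ε => r ε - s ε) (𝓝[>] 0) (𝓝 ((2 : ℝ) • y)) := by
    simpa [two_smul] using hr.sub hs
  have h_point : Tendsto (fun ε => z - (v + √ε • s ε)) (𝓝[>] 0) (𝓝 (z - v)) := by
    simpa using (tendsto_const_nhds (x := z)).sub
      ((tendsto_const_nhds (x := v)).add (tendsto_sqrt_nhdsGT_zero.smul hs))
  have h_ne : wedge ((2 : ℝ) • y) (z - v) ≠ 0 := by
    rw [wedge_swap, wedge_smul_right, neg_ne_zero, mul_ne_zero_iff, wedge_swap, neg_ne_zero]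
    exact ⟨two_ne_zero, h⟩
  filter_upwards [eventually_wedge_ne_zero h_sub h_point h_ne, self_mem_nhdsWithin] with ε h_ε hε
  convert mul_ne_zero (neg_ne_zero.2 (Real.sqrt_ne_zero'.2 hε)) h_ε using 1
  simp only [wedge, Pi.sub_apply, Pi.add_apply, Pi.smul_apply, smul_eq_mul]
  ring

end LocalFeet

/-! ### General position -/

section Generic

variable {σ K : Type*} [Field K]

variable (σ K) in
/-- The filter of generic points of affine space: a property holds eventually along it if it holds
at all points at which some fixed nonzero polynomial does not vanish. -/
def generic : Filter (σ → K) where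
  sets := {S | ∃ f : MvPolynomial σ K, f ≠ 0 ∧ ∀ z, eval z f ≠ 0 → z ∈ S}
  univ_sets := ⟨1, one_ne_zero, fun _ _ => trivial⟩
  sets_of_superset := fun ⟨f, hf, h⟩ hST => ⟨f, hf, fun z hz => hST (h z hz)⟩
  inter_sets := fun ⟨f, hf, hS⟩ ⟨g, hg, hT⟩ => ⟨f * g, mul_ne_zero hf hg, fun z hz => by
    rw [map_mul] at hz
    exact ⟨hS z (left_ne_zero_of_mul hz), hT z (right_ne_zero_of_mul hz)⟩⟩

instance generic_neBot [Infinite K] : (generic σ K).NeBot := by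
  rw [neBot_iff, Ne, ← empty_mem_iff_bot]
  rintro ⟨f, hf, h⟩
  exact hf (MvPolynomial.funext fun z => by simpa using h z)

theorem eventually_generic_eval_ne_zero {f : MvPolynomial σ K} {w : σ → K} (h : eval w f ≠ 0) :
    ∀ᶠ z in generic σ K, eval z f ≠ 0 := by
  refine ⟨f, ?_, fun _ => id⟩
  rintro rfl
  exact h (map_zero _)

theorem eventually_generic_wedge_ne_zero (v : Fin 2 → K) {u : Fin 2 → K} (hu : u ≠ 0) :
    ∀ᶠ z in generic (Fin 2) K, wedge (z - v) u ≠ 0 := by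
  have h_eval (z : Fin 2 → K) : wedge (z - v) u =
      eval z ((X 0 - C (v 0)) * C (u 1) - (X 1 - C (v 1)) * C (u 0)) := by
    simp [wedge]
  obtain ⟨w, hw⟩ := exists_wedge_ne_zero hu
  simp only [h_eval]
  refine eventually_generic_eval_ne_zero (w := v + w) ?_
  rwa [← h_eval, add_sub_cancel_left, wedge_swap, neg_ne_zero]

theorem eventually_generic_wedge_nodeDirection_ne_zero (v : Fin 2 → K) {a b : Fin 2 → K}
    (h : wedge a b ≠ 0) (ha : a ⬝ᵥ a ≠ 0) :
    ∀ᶠ z in generic (Fin 2) K, wedge (nodeDirection a b (z - v)) (z - v) ≠ 0 := by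
  have h_eval (z : Fin 2 → K) : wedge (nodeDirection a b (z - v)) (z - v) =
      eval z (C (wedge a b)⁻¹ *
        (((X 0 - C (v 0)) * C (a 1) - (X 1 - C (v 1)) * C (a 0)) *
            ((X 0 - C (v 0)) * C (b 0) + (X 1 - C (v 1)) * C (b 1)) +
          ((X 0 - C (v 0)) * C (b 1) - (X 1 - C (v 1)) * C (b 0)) *
            ((X 0 - C (v 0)) * C (a 0) + (X 1 - C (v 1)) * C (a 1)))) := by
    rw [wedge_nodeDirection]
    simp [wedge, dotProduct, Fin.sum_univ_two]
  simp only [h_eval]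
  refine eventually_generic_eval_ne_zero (w := v + a) ?_
  rw [← h_eval, add_sub_cancel_left, wedge_nodeDirection, wedge_self, zero_mul, zero_add]
  exact mul_ne_zero (inv_ne_zero h) (mul_ne_zero h ha)

end Generic

section Line

variable {K : Type*} [Field K] {a b l : Fin 3 → K} {z v : Fin 2 → K}

/-- The intersection point of two lines. If they are parallel, this is `0` by the convention
`0⁻¹ = 0`. -/
def nodePoint (a b : Fin 3 → K) : Fin 2 → K :=
  (wedge (conormal a) (conormal b))⁻¹ • ![a 1 * b 2 - b 1 * a 2, a 2 * b 0 - a 0 * b 2]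

theorem nodePoint_swap (a b : Fin 3 → K) : nodePoint b a = nodePoint a b := by
  rw [nodePoint, nodePoint, wedge_swap, inv_neg, neg_smul, ← smul_neg]
  congr 1
  ext i
  fin_cases i <;> simp [mul_comm]

theorem eval_nodePoint_left (h : wedge (conormal a) (conormal b) ≠ 0) :
    eval (nodePoint a b) (affineForm a) = 0 := by
  rw [eval_affineForm, nodePoint, smul_dotProduct, smul_eq_mul, add_eq_zero_iff_eq_neg,
    inv_mul_eq_iff_eq_mul₀ h]
  simp [conormal, wedge]
  ring

theorem eval_nodePoint_right (h : wedge (conormal a) (conormal b) ≠ 0) :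
    eval (nodePoint a b) (affineForm b) = 0 := by
  rw [← nodePoint_swap]
  exact eval_nodePoint_left (by rwa [wedge_swap, neg_ne_zero])

theorem eq_nodePoint (h : wedge (conormal a) (conormal b) ≠ 0) (ha : eval v (affineForm a) = 0)
    (hb : eval v (affineForm b) = 0) : v = nodePoint a b := by
  have ha' := eval_nodePoint_left h
  have hb' := eval_nodePoint_right h
  rw [eval_affineForm] at ha hb ha' hb'
  refine sub_eq_zero.1 (eq_zero_of_dotProduct_eq_zero h ?_ ?_)
  · rw [dotProduct_comm, sub_dotProduct]
    linear_combination ha - ha'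
  · rw [dotProduct_comm, sub_dotProduct]
    linear_combination hb - hb'

/-- The foot of the perpendicular from `z` to the line `l`. -/
def perpFoot (l : Fin 3 → K) (z : Fin 2 → K) : Fin 2 → K :=
  z - (eval z (affineForm l) / (conormal l ⬝ᵥ conormal l)) • conormal l

theorem eval_perpFoot (hl : conormal l ⬝ᵥ conormal l ≠ 0) (z : Fin 2 → K) :
    eval (perpFoot l z) (affineForm l) = 0 := by
  rw [perpFoot, eval_affineForm, sub_dotProduct, smul_dotProduct, smul_eq_mul,
    div_mul_cancel₀ _ hl, eval_affineForm]
  ring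

theorem wedge_sub_perpFoot (l : Fin 3 → K) (z u : Fin 2 → K) : wedge u (perpFoot l z - z) =
    -(eval z (affineForm l) / (conormal l ⬝ᵥ conormal l)) * wedge u (conormal l) := by
  rw [← wedge_smul_right, perpFoot, sub_sub_cancel_left, neg_smul]

theorem wedge_conormal_sub_perpFoot (l : Fin 3 → K) (z : Fin 2 → K) :
    wedge (z - perpFoot l z) (conormal l) = 0 := by
  rw [perpFoot, sub_sub_cancel, wedge_swap, wedge_smul_right, wedge_self, mul_zero, neg_zero]

end Line

section Arrangement

variable {d : ℕ} {L : Fin d → Fin 3 → ℝ} {z : Fin 2 → ℝ} {i j k l : Fin d}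

theorem exists_isGenericArrangement (d : ℕ) : ∃ L : Fin d → Fin 3 → ℝ, IsGenericArrangement L := by
  have h_ne {i j : Fin d} (hij : i ≠ j) : ((i : ℕ) : ℝ) - ((j : ℕ) : ℝ) ≠ 0 :=
    sub_ne_zero.2 fun h => hij (Fin.ext (by exact_mod_cast h))
  -- the tangent lines of the parabola `4 * y = x ^ 2`
  refine ⟨fun i => ![((i : ℕ) : ℝ), -1, -((i : ℕ) : ℝ) ^ 2], fun i => Or.inr (by simp),
    fun i j hij => ?_, ?_⟩
  · simp only [Matrix.cons_val_zero, Matrix.cons_val_one]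
    convert h_ne hij.symm using 1
    ring
  · rintro i j k hij hik hjk v ⟨hi, hj, hk⟩
    rw [linePoly_eq_affineForm, eval_affineForm] at hi hj hk
    simp only [conormal, dotProduct, Fin.sum_univ_two, Matrix.cons_val_zero, Matrix.cons_val_one,
      Matrix.cons_val] at hi hj hk
    have h_ij : v 0 - ((i : ℕ) : ℝ) - ((j : ℕ) : ℝ) = 0 :=
      (mul_eq_zero.1 (by linear_combination hi - hj)).resolve_left (h_ne hij)
    have h_ik : v 0 - ((i : ℕ) : ℝ) - ((k : ℕ) : ℝ) = 0 :=
      (mul_eq_zero.1 (by linear_combination hi - hk)).resolve_left (h_ne hik)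
    exact h_ne hjk (by linear_combination h_ik - h_ij)

theorem mem_nodes_iff {v : Fin 2 → ℝ} : v ∈ nodes L ↔
    ∃ i j, i ≠ j ∧ eval v (affineForm (L i)) = 0 ∧ eval v (affineForm (L j)) = 0 := by
  simp only [← linePoly_eq_affineForm]
  rfl

namespace IsGenericArrangement

theorem conormal_ne_zero (hL : IsGenericArrangement L) (i : Fin d) : conormal (L i) ≠ 0 := by
  intro h
  exact (hL.isLine i).elim (· (congrFun h 0)) (· (congrFun h 1))

theorem dotProduct_conormal_ne_zero (hL : IsGenericArrangement L) (i : Fin d) :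
    conormal (L i) ⬝ᵥ conormal (L i) ≠ 0 :=
  dotProduct_self_eq_zero.not.2 (hL.conormal_ne_zero i)

theorem wedge_conormal_ne_zero (hL : IsGenericArrangement L) (hij : i ≠ j) :
    wedge (conormal (L i)) (conormal (L j)) ≠ 0 :=
  hL.not_parallel i j hij

theorem eval_nodePoint_eq_zero_iff (hL : IsGenericArrangement L) (hij : i ≠ j) :
    eval (nodePoint (L i) (L j)) (affineForm (L k)) = 0 ↔ k = i ∨ k = j := by
  have hi := eval_nodePoint_left (hL.wedge_conormal_ne_zero hij)
  have hj := eval_nodePoint_right (hL.wedge_conormal_ne_zero hij)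
  refine ⟨fun hk => ?_, ?_⟩
  · by_contra! h
    simp only [← linePoly_eq_affineForm] at hi hj hk
    exact hL.not_concurrent i j k hij h.1.symm h.2.symm _ ⟨hi, hj, hk⟩
  · rintro (rfl | rfl)
    exacts [hi, hj]

theorem nodePoint_mem_nodes (hL : IsGenericArrangement L) (hij : i ≠ j) :
    nodePoint (L i) (L j) ∈ nodes L :=
  mem_nodes_iff.2 ⟨i, j, hij, eval_nodePoint_left (hL.wedge_conormal_ne_zero hij),
    eval_nodePoint_right (hL.wedge_conormal_ne_zero hij)⟩

theorem exists_eq_nodePoint (hL : IsGenericArrangement L) {v : Fin 2 → ℝ} (hv : v ∈ nodes L) :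
    ∃ i j, i ≠ j ∧ v = nodePoint (L i) (L j) := by
  obtain ⟨i, j, hij, hi, hj⟩ := mem_nodes_iff.1 hv
  exact ⟨i, j, hij, eq_nodePoint (hL.wedge_conormal_ne_zero hij) hi hj⟩

theorem nodePoint_ne_nodePoint (hL : IsGenericArrangement L) (hij : i ≠ j) (hkl : k ≠ l)
    (h : (i, j) ≠ (k, l)) (h_swap : (i, j) ≠ (l, k)) :
    nodePoint (L i) (L j) ≠ nodePoint (L k) (L l) := by
  intro h_eq
  have hk := (hL.eval_nodePoint_eq_zero_iff (k := k) hij).1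
    (by rw [h_eq, hL.eval_nodePoint_eq_zero_iff hkl]; exact Or.inl rfl)
  have hl := (hL.eval_nodePoint_eq_zero_iff (k := l) hij).1
    (by rw [h_eq, hL.eval_nodePoint_eq_zero_iff hkl]; exact Or.inr rfl)
  grind

theorem finite_nodes (hL : IsGenericArrangement L) : (nodes L).Finite := by
  refine (Set.finite_range fun x : Fin d × Fin d => nodePoint (L x.1) (L x.2)).subset fun v hv => ?_
  obtain ⟨i, j, -, rfl⟩ := hL.exists_eq_nodePoint hv
  exact ⟨(i, j), rfl⟩

end IsGenericArrangement

/-- The point `z` is in general position with respect to the arrangement: the limits of the feet of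
normals through `z` to a smoothing are seen from `z` in different directions, and at every node the
directions in which two of the feet leave it do not point towards `z`. -/
structure IsGeneralPoint (L : Fin d → Fin 3 → ℝ) (z : Fin 2 → ℝ) : Prop where
  eval_ne_zero : ∀ i, eval z (affineForm (L i)) ≠ 0
  wedge_conormal_ne_zero : ∀ v ∈ nodes L, ∀ i, wedge (z - v) (conormal (L i)) ≠ 0
  wedge_nodeDirection_ne_zero : ∀ i j, i ≠ j →
    wedge (nodeDirection (conormal (L i)) (conormal (L j)) (z - nodePoint (L i) (L j)))
      (z - nodePoint (L i) (L j)) ≠ 0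
  wedge_sub_ne_zero : ∀ v ∈ nodes L, ∀ w ∈ nodes L, v ≠ w → wedge (z - v) (w - v) ≠ 0

theorem IsGenericArrangement.eventually_isGeneralPoint (hL : IsGenericArrangement L) :
    ∀ᶠ z in generic (Fin 2) ℝ, IsGeneralPoint L z := by
  have h_eval : ∀ᶠ z in generic (Fin 2) ℝ, ∀ i, eval z (affineForm (L i)) ≠ 0 := by
    refine eventually_all.2 fun i =>
      eventually_generic_eval_ne_zero (w := perpFoot (L i) 0 + conormal (L i)) ?_
    have h_foot := eval_perpFoot (hL.dotProduct_conormal_ne_zero i) 0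
    rw [eval_affineForm] at h_foot ⊢
    rw [add_dotProduct, add_right_comm, h_foot, zero_add]
    exact hL.dotProduct_conormal_ne_zero i
  have h_conormal := hL.finite_nodes.eventually_all.2 fun v _ =>
    eventually_all.2 fun i => eventually_generic_wedge_ne_zero v (hL.conormal_ne_zero i)
  have h_direction : ∀ᶠ z in generic (Fin 2) ℝ, ∀ i j, i ≠ j →
      wedge (nodeDirection (conormal (L i)) (conormal (L j)) (z - nodePoint (L i) (L j)))
        (z - nodePoint (L i) (L j)) ≠ 0 := by
    simp only [eventually_all]
    exact fun i j hij => eventually_generic_wedge_nodeDirection_ne_zero _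
      (hL.wedge_conormal_ne_zero hij) (hL.dotProduct_conormal_ne_zero i)
  have h_nodes : ∀ᶠ z in generic (Fin 2) ℝ, ∀ v ∈ nodes L, ∀ w ∈ nodes L, v ≠ w →
      wedge (z - v) (w - v) ≠ 0 := by
    simp only [hL.finite_nodes.eventually_all, eventually_all]
    exact fun v _ w _ hvw => eventually_generic_wedge_ne_zero v (sub_ne_zero.2 hvw.symm)
  filter_upwards [h_eval, h_conormal, h_direction, h_nodes] with z h₁ h₂ h₃ h₄
  exact ⟨h₁, h₂, h₃, h₄⟩

/-- The limits, as the smoothing approaches the arrangement, of the feet of normals through `z`. -/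
def footLimit (L : Fin d → Fin 3 → ℝ) (z : Fin 2 → ℝ) (x : Fin d × Fin d) : Fin 2 → ℝ :=
  if x.1 = x.2 then perpFoot (L x.1) z else nodePoint (L x.1) (L x.2)

namespace IsGeneralPoint

theorem wedge_perpFoot_ne_zero (hz : IsGeneralPoint L z) (hL : IsGenericArrangement L)
    {u : Fin 2 → ℝ} (h : wedge u (conormal (L i)) ≠ 0) : wedge u (perpFoot (L i) z - z) ≠ 0 := by
  rw [wedge_sub_perpFoot]
  exact mul_ne_zero (neg_ne_zero.2 (div_ne_zero (hz.eval_ne_zero i)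
    (hL.dotProduct_conormal_ne_zero i))) h

theorem wedge_footLimit_ne_zero (hz : IsGeneralPoint L z) (hL : IsGenericArrangement L)
    {x y : Fin d × Fin d} (hxy : x ≠ y) (h_swap : x ≠ y.swap) :
    wedge (footLimit L z x - z) (footLimit L z y - z) ≠ 0 := by
  obtain ⟨i, j⟩ := x
  obtain ⟨k, l⟩ := y
  have h_mixed {i j k : Fin d} (hij : i ≠ j) :
      wedge (nodePoint (L i) (L j) - z) (perpFoot (L k) z - z) ≠ 0 := by
    refine hz.wedge_perpFoot_ne_zero hL ?_
    convert neg_ne_zero.2 (hz.wedge_conormal_ne_zero _ (hL.nodePoint_mem_nodes hij) k) using 1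
    simp only [wedge, Pi.sub_apply]
    ring
  by_cases hij : i = j <;> by_cases hkl : k = l <;>
    simp only [footLimit, hij, hkl, if_true, if_false]
  · refine hz.wedge_perpFoot_ne_zero hL ?_
    rw [wedge_swap, neg_ne_zero]
    refine hz.wedge_perpFoot_ne_zero hL (hL.wedge_conormal_ne_zero ?_)
    rintro rfl
    exact hxy (by rw [hij, hkl])
  · rw [wedge_swap, neg_ne_zero]
    exact h_mixed hkl
  · exact h_mixed hij
  · convert neg_ne_zero.2 (hz.wedge_sub_ne_zero _ (hL.nodePoint_mem_nodes hij) _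
      (hL.nodePoint_mem_nodes hkl) (hL.nodePoint_ne_nodePoint hij hkl hxy h_swap)) using 1
    simp only [wedge, Pi.sub_apply]
    ring

end IsGeneralPoint

end Arrangement

/-! ### Admissible smoothings -/

section Smoothing

theorem prod_eq_mul_prod_erase_erase {ι M : Type*} [Fintype ι] [DecidableEq ι] [CommMonoid M]
    {i j : ι} (hij : i ≠ j) (f : ι → M) :
    ∏ k, f k = f i * (f j * ∏ k ∈ (Finset.univ.erase i).erase j, f k) := by
  rw [Finset.mul_prod_erase _ f (by simp [hij.symm]), Finset.mul_prod_erase _ f (Finset.mem_univ i)]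

variable {d : ℕ} {L : Fin d → Fin 3 → ℝ} {z : Fin 2 → ℝ} {H : MvPolynomial (Fin 2) ℝ} {i j : Fin d}

/-- The product of the equations of the lines of the arrangement that do not contain `v`. -/
def linesAvoiding (L : Fin d → Fin 3 → ℝ) (v : Fin 2 → ℝ) : MvPolynomial (Fin 2) ℝ :=
  ∏ k with eval v (affineForm (L k)) ≠ 0, affineForm (L k)

theorem eval_linesAvoiding_self_ne_zero (L : Fin d → Fin 3 → ℝ) (v : Fin 2 → ℝ) :
    eval v (linesAvoiding L v) ≠ 0 := by
  rw [linesAvoiding, map_prod, Finset.prod_ne_zero_iff]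
  exact fun k hk => (Finset.mem_filter.1 hk).2

theorem totalDegree_linesAvoiding_lt {v : Fin 2 → ℝ} (hv : v ∈ nodes L) :
    (linesAvoiding L v).totalDegree < d := by
  obtain ⟨i, -, -, hi, -⟩ := mem_nodes_iff.1 hv
  refine (totalDegree_prod_affineForm_le _ _).trans_lt ?_
  conv_rhs => rw [← Finset.card_fin d]
  exact Finset.card_lt_card (Finset.filter_ssubset.2 ⟨i, Finset.mem_univ i, by simp [hi]⟩)

theorem IsGenericArrangement.eval_linesAvoiding (hL : IsGenericArrangement L) {v w : Fin 2 → ℝ}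
    (hv : v ∈ nodes L) (hvw : v ≠ w) : eval v (linesAvoiding L w) = 0 := by
  obtain ⟨i, j, hij, hi, hj⟩ := mem_nodes_iff.1 hv
  rw [linesAvoiding, map_prod, Finset.prod_eq_zero_iff]
  by_contra! h
  have h_mem {k : Fin d} (hk : eval v (affineForm (L k)) = 0) : eval w (affineForm (L k)) = 0 := by
    by_contra h_ne
    exact h k (by simpa using h_ne) hk
  have h_parallel := hL.wedge_conormal_ne_zero hij
  exact hvw ((eq_nodePoint h_parallel hi hj).trans
    (eq_nodePoint h_parallel (h_mem hi) (h_mem hj)).symm)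

theorem IsGenericArrangement.exists_interpolation (hL : IsGenericArrangement L) (hd : 0 < d)
    (g : (Fin 2 → ℝ) → ℝ) :
    ∃ H : MvPolynomial (Fin 2) ℝ, H.totalDegree < d ∧ ∀ v ∈ nodes L, eval v H = g v := by
  have h_finite := hL.finite_nodes
  refine ⟨∑ w ∈ h_finite.toFinset,
    C (g w / eval w (linesAvoiding L w)) * linesAvoiding L w, ?_, fun v hv => ?_⟩
  · refine (totalDegree_finsetSum _ _).trans_lt ((Finset.sup_lt_iff hd).2 fun w hw => ?_)
    refine (totalDegree_mul _ _).trans_lt ?_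
    rw [totalDegree_C, zero_add]
    exact totalDegree_linesAvoiding_lt (h_finite.mem_toFinset.1 hw)
  · rw [map_sum, Finset.sum_eq_single v]
    · rw [map_mul, eval_C, div_mul_cancel₀ _ (eval_linesAvoiding_self_ne_zero L v)]
    · intro w _ hwv
      rw [map_mul, hL.eval_linesAvoiding hv hwv.symm, mul_zero]
    · intro h
      exact absurd (h_finite.mem_toFinset.2 hv) h

open Classical in
/-- The value at the node `v` of the smoothing term for which two of the feet of normals through
`z` tend to `v`; see `exists_tendsto_isFoot_of_node`. -/
def nodeValue (L : Fin d → Fin 3 → ℝ) (z v : Fin 2 → ℝ) : ℝ :=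
  ∏ k, if eval v (affineForm (L k)) = 0 then wedge (z - v) (conormal (L k))
    else eval v (affineForm (L k))

theorem IsGeneralPoint.nodeValue_ne_zero (hz : IsGeneralPoint L z) {v : Fin 2 → ℝ}
    (hv : v ∈ nodes L) : nodeValue L z v ≠ 0 := by
  refine Finset.prod_ne_zero_iff.2 fun k _ => ?_
  split_ifs with hk
  exacts [hz.wedge_conormal_ne_zero v hv k, hk]

theorem IsGenericArrangement.nodeValue_nodePoint (hL : IsGenericArrangement L) (hij : i ≠ j) :
    nodeValue L z (nodePoint (L i) (L j)) =
      wedge (z - nodePoint (L i) (L j)) (conormal (L i)) *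
        wedge (z - nodePoint (L i) (L j)) (conormal (L j)) *
          eval (nodePoint (L i) (L j)) (∏ k ∈ (Finset.univ.erase i).erase j, affineForm (L k)) := by
  rw [nodeValue, prod_eq_mul_prod_erase_erase hij, map_prod, mul_assoc,
    if_pos ((hL.eval_nodePoint_eq_zero_iff hij).2 (Or.inl rfl)),
    if_pos ((hL.eval_nodePoint_eq_zero_iff hij).2 (Or.inr rfl))]
  congr 2
  refine Finset.prod_congr rfl fun k hk => if_neg ?_
  rw [hL.eval_nodePoint_eq_zero_iff hij]
  simpa [and_comm] using hk

theorem smoothing_eq (L : Fin d → Fin 3 → ℝ) (H : MvPolynomial (Fin 2) ℝ) (ε : ℝ) :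
    smoothing L H ε = ∏ k, affineForm (L k) + C ε * H := by
  simp only [smoothing, linePoly_eq_affineForm]

theorem IsGeneralPoint.exists_tendsto_perpFoot (hz : IsGeneralPoint L z)
    (hL : IsGenericArrangement L) (H : MvPolynomial (Fin 2) ℝ) (i : Fin d) :
    ∃ p : ℝ → Fin 2 → ℝ, Tendsto p (𝓝[>] 0) (𝓝 (perpFoot (L i) z)) ∧
      ∀ᶠ ε in 𝓝[>] 0, IsFoot (smoothing L H ε) z (p ε) := by
  have h_foot := eval_perpFoot (hL.dotProduct_conormal_ne_zero i) z
  simp only [smoothing_eq,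
    ← Finset.mul_prod_erase _ (fun k => affineForm (L k)) (Finset.mem_univ i)]
  refine exists_tendsto_isFoot_of_perpendicular (hL.conormal_ne_zero i) h_foot
    (wedge_conormal_sub_perpFoot _ _) ?_ H
  rw [map_prod, Finset.prod_ne_zero_iff]
  intro k hk h_zero
  have hik : i ≠ k := (Finset.ne_of_mem_erase hk).symm
  exact hz.wedge_conormal_ne_zero _ (mem_nodes_iff.2 ⟨i, k, hik, h_foot, h_zero⟩) i
    (wedge_conormal_sub_perpFoot _ _)

theorem IsGeneralPoint.exists_tendsto_nodePoint (hz : IsGeneralPoint L z)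
    (hL : IsGenericArrangement L) (hH : ∀ v ∈ nodes L, eval v H = nodeValue L z v) (hij : i ≠ j) :
    ∃ r : ℝ → Fin 2 → ℝ,
      Tendsto r (𝓝[>] 0) (𝓝 (nodeDirection (conormal (L i)) (conormal (L j))
        (z - nodePoint (L i) (L j)))) ∧
      ∀ᶠ ε in 𝓝[>] 0, IsFoot (smoothing L H ε) z (nodePoint (L i) (L j) + √ε • r ε) := by
  have h_parallel := hL.wedge_conormal_ne_zero hij
  have h_node := hL.nodePoint_mem_nodes hij
  simp only [smoothing_eq, prod_eq_mul_prod_erase_erase hij]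
  refine exists_tendsto_isFoot_of_node h_parallel (eval_nodePoint_left h_parallel)
    (eval_nodePoint_right h_parallel) (hz.wedge_conormal_ne_zero _ h_node i)
    (hz.wedge_conormal_ne_zero _ h_node j) ?_ ?_
  · rw [map_prod, Finset.prod_ne_zero_iff]
    intro k hk
    rw [Ne, hL.eval_nodePoint_eq_zero_iff hij]
    simpa [and_comm] using hk
  · rw [hH _ h_node, hL.nodeValue_nodePoint hij]

/-- Paths `P x` of feet of normals through `z` to the smoothings, which for small `ε` are seen from
`z` in different directions, and which start at the points `footLimit L z x`. -/
structure IsFootPaths (L : Fin d → Fin 3 → ℝ) (H : MvPolynomial (Fin 2) ℝ) (z : Fin 2 → ℝ)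
    (P : Fin d × Fin d → ℝ → Fin 2 → ℝ) : Prop where
  tendsto : ∀ x, Tendsto (P x) (𝓝[>] 0) (𝓝 (footLimit L z x))
  isFoot : ∀ x, ∀ᶠ ε in 𝓝[>] 0, IsFoot (smoothing L H ε) z (P x ε)
  wedge_ne_zero : ∀ x y, x ≠ y → ∀ᶠ ε in 𝓝[>] 0, wedge (P x ε - z) (P y ε - z) ≠ 0

theorem tendsto_add_sqrt_smul {r : ℝ → Fin 2 → ℝ} {y : Fin 2 → ℝ} (hr : Tendsto r (𝓝[>] 0) (𝓝 y))
    (v : Fin 2 → ℝ) : Tendsto (fun ε => v + √ε • r ε) (𝓝[>] 0) (𝓝 v) := by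
  simpa using (tendsto_const_nhds (x := v)).add (tendsto_sqrt_nhdsGT_zero.smul hr)

theorem IsGeneralPoint.exists_isFootPaths (hz : IsGeneralPoint L z) (hL : IsGenericArrangement L)
    (hH : ∀ v ∈ nodes L, eval v H = nodeValue L z v) : ∃ P, IsFootPaths L H z P := by
  choose p hp h_footp using hz.exists_tendsto_perpFoot hL H
  choose! r hr h_footr using fun i j hij => hz.exists_tendsto_nodePoint hL hH (i := i) (j := j) hij
  let P (x : Fin d × Fin d) (ε : ℝ) : Fin 2 → ℝ :=
    if x.1 = x.2 then p x.1 ε else nodePoint (L x.1) (L x.2) + √ε • r x.1 x.2 ε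
  have h_tendsto (x) : Tendsto (P x) (𝓝[>] 0) (𝓝 (footLimit L z x)) := by
    by_cases hx : x.1 = x.2
    · simpa only [P, footLimit, if_pos hx] using hp x.1
    · simpa only [P, footLimit, if_neg hx] using tendsto_add_sqrt_smul (hr x.1 x.2 hx) _
  refine ⟨P, h_tendsto, fun x => ?_, fun x y hxy => ?_⟩
  · by_cases hx : x.1 = x.2
    · simpa only [P, if_pos hx] using h_footp x.1
    · simpa only [P, if_neg hx] using h_footr x.1 x.2 hx
  by_cases h_swap : x = y.swap
  · obtain ⟨i, j⟩ := y
    subst h_swap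
    have hij : i ≠ j := fun h => hxy (by rw [h]; rfl)
    simp only [P, Prod.fst_swap, Prod.snd_swap, if_neg hij, if_neg hij.symm]
    rw [nodePoint_swap (L i) (L j)]
    refine eventually_wedge_add_smul_ne_zero (hr j i hij.symm) ?_ ?_
    · rw [← nodeDirection_swap, nodePoint_swap (L i)]
      exact hr i j hij
    · simpa only [nodePoint_swap (L i) (L j)] using
        hz.wedge_nodeDirection_ne_zero j i hij.symm
  · exact eventually_wedge_ne_zero ((h_tendsto x).sub_const z) ((h_tendsto y).sub_const z)
      (hz.wedge_footLimit_ne_zero hL hxy h_swap)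

theorem IsFootPaths.isAdmissibleAt {P : Fin d × Fin d → ℝ → Fin 2 → ℝ} (hP : IsFootPaths L H z P)
    (hij : i ≠ j) : IsAdmissibleAt L H z (nodePoint (L i) (L j)) := by
  have h_left := hP.tendsto (i, j)
  have h_right := hP.tendsto (j, i)
  rw [footLimit, if_neg hij] at h_left
  rw [footLimit, if_neg hij.symm, nodePoint_swap] at h_right
  intro U hU
  filter_upwards [h_left.eventually_mem hU, h_right.eventually_mem hU, hP.isFoot (i, j),
    hP.isFoot (j, i), hP.wedge_ne_zero (i, j) (j, i) fun h => hij (congrArg Prod.fst h)]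
    with ε h_leftU h_rightU hp hq h_ne
  exact ⟨_, h_leftU, _, h_rightU, hp.normal, hp.normal_mem_pencil, hq.normal, hq.normal_mem_pencil,
    hp.normal_ne_normal hq h_ne, hp.isNormalAt, hq.isNormalAt⟩

theorem totalDegree_C_mul_lt_card (hH : H.totalDegree < d) (ε : ℝ) :
    (C ε * H).totalDegree < Fintype.card (Fin d) := by
  rw [C_mul', Fintype.card_fin]
  exact (totalDegree_smul_le ε H).trans_lt hH

theorem IsGenericArrangement.totalDegree_smoothing (hL : IsGenericArrangement L)
    (hH : H.totalDegree < d) (ε : ℝ) : (smoothing L H ε).totalDegree = d := by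
  rw [smoothing_eq, totalDegree_prod_affineForm_add hL.conormal_ne_zero
    (totalDegree_C_mul_lt_card hH ε), Fintype.card_fin]

theorem IsGenericArrangement.hasNoCircularComponent_smoothing (hL : IsGenericArrangement L)
    (hH : H.totalDegree < d) (ε : ℝ) : HasNoCircularComponent (smoothing L H ε) := by
  rw [smoothing_eq]
  exact hasNoCircularComponent_prod_affineForm_add (fun i j hij => hL.wedge_conormal_ne_zero hij)
    hL.dotProduct_conormal_ne_zero (totalDegree_C_mul_lt_card hH ε)

theorem IsGenericArrangement.hasNoCircularComponent_complexify_smoothing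
    (hL : IsGenericArrangement L) (hH : H.totalDegree < d) (ε : ℝ) :
    HasNoCircularComponent (complexify (smoothing L H ε)) := by
  rw [smoothing_eq, complexify_prod_affineForm_add]
  refine hasNoCircularComponent_prod_affineForm_add (fun i j hij => ?_) (fun i => ?_) ?_
  · simp only [conormal_ofReal, wedge_toComplex]
    exact Complex.ofReal_ne_zero.2 (hL.wedge_conormal_ne_zero hij)
  · rw [conormal_ofReal, dotProduct_toComplex]
    exact Complex.ofReal_ne_zero.2 (hL.dotProduct_conormal_ne_zero i)
  · rw [totalDegree_complexify]
    exact totalDegree_C_mul_lt_card hH ε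

theorem IsFootPaths.eventually_isFullFootSystem {P : Fin d × Fin d → ℝ → Fin 2 → ℝ}
    (hP : IsFootPaths L H z P) (hL : IsGenericArrangement L) (hH : H.totalDegree < d) :
    ∀ᶠ ε in 𝓝[>] 0, IsFullFootSystem (smoothing L H ε) z fun x => P x ε := by
  have h_wedge : ∀ᶠ ε in 𝓝[>] 0, ∀ x y, x ≠ y → wedge (P x ε - z) (P y ε - z) ≠ 0 := by
    simpa only [eventually_all] using hP.wedge_ne_zero
  filter_upwards [eventually_all.2 hP.isFoot, h_wedge] with ε h_foot h_wedge
  have h_degree := hL.totalDegree_smoothing hH ε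
  exact ⟨hL.hasNoCircularComponent_smoothing hH ε, by omega, by simp [h_degree, sq], h_foot,
    fun x y hxy => h_wedge x y hxy⟩

theorem IsGenericArrangement.exists_admissible (hL : IsGenericArrangement L) (hd : 0 < d) :
    ∃ z : Fin 2 → ℝ, (∀ i, eval z (linePoly (L i)) ≠ 0) ∧ ∃ H : MvPolynomial (Fin 2) ℝ,
      IsAdmissibleSmoothing L H z ∧ H.totalDegree < d ∧
      ∀ᶠ ε in 𝓝[>] 0, ∃ P : Fin d × Fin d → Fin 2 → ℝ,
        IsFullFootSystem (smoothing L H ε) z P := by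
  obtain ⟨z, hz⟩ := hL.eventually_isGeneralPoint.exists
  obtain ⟨H, h_degree, hH⟩ := hL.exists_interpolation hd (nodeValue L z)
  obtain ⟨P, hP⟩ := hz.exists_isFootPaths hL hH
  refine ⟨z, fun i => linePoly_eq_affineForm (L i) ▸ hz.eval_ne_zero i, H,
    ⟨h_degree.le, fun v hv => (hH v hv).symm ▸ hz.nodeValue_ne_zero hv, fun v hv => ?_⟩, h_degree,
    (hP.eventually_isFullFootSystem hL h_degree).mono fun ε h => ⟨_, h⟩⟩
  obtain ⟨i, j, hij, rfl⟩ := hL.exists_eq_nodePoint hv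
  exact hP.isAdmissibleAt hij

end Smoothing

end PlaneNormals

end

theorem mainTheorem2 (d : ℕ) (hd : 1 ≤ d) :
    (∃ L : Fin d → Fin 3 → ℝ, PlaneNormals.IsGenericArrangement L) ∧
    (∀ L : Fin d → Fin 3 → ℝ, PlaneNormals.IsGenericArrangement L →
      ∃ z : Fin 2 → ℝ, (∀ i, eval z (PlaneNormals.linePoly (L i)) ≠ 0) ∧
      ∃ H : MvPolynomial (Fin 2) ℝ, PlaneNormals.IsAdmissibleSmoothing L H z ∧
      ∀ᶠ ε in 𝓝[>] (0 : ℝ), ∀ f : MvPolynomial (Fin 2) ℝ, f = PlaneNormals.smoothing L H ε →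
        f.totalDegree = d ∧
        PlaneNormals.IsNonsingular (PlaneNormals.complexify f) ∧
        (PlaneNormals.normalsThrough (PlaneNormals.complexify f)
          (PlaneNormals.toComplex z)).encard = (d : ℕ∞) ^ 2 ∧
        PlaneNormals.AllNormalsReal f z ∧
        PlaneNormals.HasDegree
          (PlaneNormals.curveOfNormals (PlaneNormals.complexify f)) (d ^ 2) ∧
        PlaneNormals.realDegree (PlaneNormals.curveOfNormals f) = (d : ℕ∞) ^ 2) ∧
    IsGreatest {r : ℕ∞ | ∃ f : MvPolynomial (Fin 2) ℝ, Squarefree f ∧ f.totalDegree = d ∧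
      r = PlaneNormals.realDegree (PlaneNormals.curveOfNormals f)} ((d : ℕ∞) ^ 2) := by
  open PlaneNormals in
  refine ⟨exists_isGenericArrangement d, fun L hL => ?_, ?_, ?_⟩
  · obtain ⟨z, hz, H, hH, h_lt, h_feet⟩ := hL.exists_admissible hd
    refine ⟨z, hz, H, hH, ?_⟩
    filter_upwards [h_feet]
    rintro ε ⟨P, hP⟩ f rfl
    have h_degree := hL.totalDegree_smoothing h_lt ε
    have h_complex := hL.hasNoCircularComponent_complexify_smoothing h_lt ε
    have hPC := hP.complexify h_complex
    have h_card := hPC.encard_normalsThrough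
    have h_curve := hPC.hasDegree
    have h_real := hP.realDegree_eq
    rw [totalDegree_complexify, h_degree] at h_card h_curve
    rw [h_degree] at h_real
    exact ⟨h_degree, hPC.isNonsingular, by exact_mod_cast h_card, hP.allNormalsReal h_complex,
      h_curve, h_real⟩
  · obtain ⟨L, hL⟩ := exists_isGenericArrangement d
    obtain ⟨z, -, H, -, h_lt, h_feet⟩ := hL.exists_admissible hd
    obtain ⟨ε, P, hP⟩ := h_feet.exists
    have h_degree := hL.totalDegree_smoothing h_lt ε
    exact ⟨_, hP.hasNoCircularComponent.squarefree, h_degree, by rw [hP.realDegree_eq, h_degree]⟩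
  · rintro r ⟨f, -, rfl, rfl⟩
    exact realDegree_curveOfNormals_le hd
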